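/- Consider a memoryless half-duplex network with $N$ relays: node $i\in[1:N+1]$ has input alphabet $\mathcal X_i$ and output alphabet $\mathcal Y_i$ (standard Borel spaces), where inputs of index $N+1$ belong to the source, outputs of index $N+1$ to the destination, and $k\in[1:N]$ are the relays. Relay $k$ also has a state $S_k\in\{0,1\}$ ($0$ = listening, $1$ = transmitting), and the channel is a transition probability $\mathbb P_{Y_{[1:N+1]}|X_{[1:N+1]},S_{[1:N]}}$ such that the outputs do not depend on $X_k$ when $S_k=0$, and $Y_k$ is independent of all other random variables when $S_k=1$. Assume independent noises, $\mathbb P_{Y_{[1:N+1]}|X_{[1:N+1]},S_{[1:N]}}=\prod_{i=1}^{N+1}\mathbb P_{Y_i|X_{[1:N+1]},S_{[1:N]}}$, and fix independent inputs, $\mathbb P_{X_{[1:N+1]}|S_{[1:N]}}=\prod_{i=1}^{N+1}\mathbb P_{X_i|S_{[1:N]}}$. For a schedule $\mathbb P_{S_{[1:N]}}$ (a probability mass function on $\{0,1\}^N$) and a cut $\mathcal A\subseteq[1:N]$ let $$I^{(\mathrm{fix})}_{\mathcal A}=I\big(X_{N+1},X_{\mathcal A^c};\,Y_{N+1},Y_{\mathcal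 A}\,\big|\,X_{\mathcal A},S_{[1:N]}\big),$$ and assume that all these mutual informations are finite. Let $\mathsf C'=\sup_{\mathbb P_{S_{[1:N]}}}\min_{\mathcal A\subseteq[1:N]}I^{(\mathrm{fix})}_{\mathcal A}$. Then simple schedules are optimal: there is a schedule $\mathbb P_{S_{[1:N]}}$ with at most $N+1$ non-zero entries (out of $2^N$) that attains $\mathsf C'$, that is, $\min_{\mathcal A}I^{(\mathrm{fix})}_{\mathcal A}=\mathsf C'$ for it; in particular the supremum is a maximum. Consequently, whenever the capacity $\mathsf C$ of the network (possibly under average input cost constraints, such as power constraints) satisfies $\mathsf C'-\mathsf G_1\le\mathsf C\le\mathsf C'+\mathsf G_2$ with constants $\mathsf G_1,\mathsf G_2\ge 0$, the value $\min_{\mathcal A}I^{(\mathrm{fix})}_{\mathcal A}$ of this single schedule with at most $N+1$ active states satisfies the same two bounds in place of $\mathsf C'$. -/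

import Mathlib

namespace HalfDuplex

open MeasureTheory ProbabilityTheory InformationTheory
open scoped ENNReal NNReal

/-! ### Conditional mutual information on general alphabets -/

/-- The conditional mutual information `I(U; V | Z)`, in nats, of three random variables on a
probability space: the Kullback-Leibler divergence between the joint law `P_{Z,U,V}` and
`P_Z ⊗ (P_{U|Z} × P_{V|Z})`, the law that makes `U` and `V` conditionally independent given `Z`. -/
noncomputable def condMutualInfo {Ω α β γ : Type*} [MeasurableSpace Ω]
    [MeasurableSpace α] [StandardBorelSpace α] [Nonempty α]
    [MeasurableSpace β] [StandardBorelSpace β] [Nonempty β] [MeasurableSpace γ]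
    (U : Ω → α) (V : Ω → β) (Z : Ω → γ) (μ : Measure Ω) [IsFiniteMeasure μ] : ℝ≥0∞ :=
  klDiv (μ.map (fun ω => (Z ω, (U ω, V ω))))
    ((μ.map Z) ⊗ₘ ((condDistrib U Z μ) ×ₖ (condDistrib V Z μ)))

/-! ### Half-duplex relay networks -/

/-- A joint state of the `N` relays: `s k = false` if relay `k` is listening and `s k = true` if
it is transmitting. -/
abbrev State (N : ℕ) : Type := Fin N → Bool

/-- A memoryless half-duplex network with `N` relays. Relay `k` is the node `k.castSucc`. The node
`Fin.last N` stands for the source in the input alphabets `X` and for the destination in the output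
alphabets `Y`. The channel is the transition probability from relay states and inputs to outputs.
A listening relay does not influence the outputs through its input; the output of a
transmitting relay is independent of everything else. -/
structure Network (N : ℕ) (X Y : Fin (N + 1) → Type*)
    [∀ i, MeasurableSpace (X i)] [∀ i, MeasurableSpace (Y i)] where
  /-- the law of the outputs given the relay states and the inputs -/
  channel : Kernel (State N × (∀ i, X i)) (∀ i, Y i)
  isMarkovKernel : IsMarkovKernel channel
  listening : ∀ (k : Fin N) (s : State N) (x x' : ∀ i, X i), s k = false →
    (∀ i, i ≠ k.castSucc → x i = x' i) → channel (s, x) = channel (s, x')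
  transmitting : ∀ k : Fin N, ∃ ν : Measure (Y k.castSucc),
    ∀ (s : State N) (x : ∀ i, X i), s k = true →
      (channel (s, x)).map (fun y => y k.castSucc) = ν ∧
      IndepFun (fun y : ∀ i, Y i => y k.castSucc)
        (fun (y : ∀ i, Y i) (j : {j // j ≠ k.castSucc}) => y j) (channel (s, x))

attribute [instance] Network.isMarkovKernel

section

variable {N : ℕ} {X Y : Fin (N + 1) → Type*}
  [∀ i, MeasurableSpace (X i)] [∀ i, MeasurableSpace (Y i)]

/-- Independent noises: given the relay states and all inputs, the outputs are independent, so that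
their joint conditional law is the product of its marginals. -/
def Network.IndependentNoises (W : Network N X Y) : Prop :=
  ∀ (s : State N) (x : ∀ i, X i),
    W.channel (s, x) = Measure.pi (fun i => (W.channel (s, x)).map (fun y => y i))

/-- Independent inputs: given the relay states, the inputs of the nodes are independent, so that
their joint conditional law is the product of its marginals. -/
def IndependentInputs (Q : Kernel (State N) (∀ i, X i)) : Prop :=
  ∀ s : State N, Q s = Measure.pi (fun i => (Q s).map (fun x => x i))

/-- The joint law of relay states, inputs and outputs, for the schedule `p` (the law of the relay
states) and the conditional input law `Q`. -/
noncomputable def jointLaw (W : Network N X Y) (Q : Kernel (State N) (∀ i, X i))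
    (p : PMF (State N)) : Measure ((State N × (∀ i, X i)) × (∀ i, Y i)) :=
  (p.toMeasure ⊗ₘ Q) ⊗ₘ W.channel

instance (W : Network N X Y) (Q : Kernel (State N) (∀ i, X i)) [IsMarkovKernel Q]
    (p : PMF (State N)) : IsProbabilityMeasure (jointLaw W Q p) := by
  unfold jointLaw
  infer_instance

/-- The relays of a set `A`, as nodes. -/
def relayNodes (A : Finset (Fin N)) : Finset (Fin (N + 1)) := A.map Fin.castSuccEmb

variable [∀ i, StandardBorelSpace (X i)] [∀ i, Nonempty (X i)]
  [∀ i, StandardBorelSpace (Y i)] [∀ i, Nonempty (Y i)]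

/-- The mutual information across the cut `A` with a fixed schedule,
`I(X_{N+1}, X_{Aᶜ}; Y_{N+1}, Y_A | X_A, S)`. -/
noncomputable def cutInfo (W : Network N X Y) (Q : Kernel (State N) (∀ i, X i)) [IsMarkovKernel Q]
    (p : PMF (State N)) (A : Finset (Fin N)) : ℝ≥0∞ :=
  condMutualInfo
    (fun ω : (State N × (∀ i, X i)) × (∀ i, Y i) => ((relayNodes A)ᶜ).restrict ω.1.2)
    (fun ω => (insert (Fin.last N) (relayNodes A)).restrict ω.2)
    (fun ω => ((relayNodes A).restrict ω.1.2, ω.1.1))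
    (jointLaw W Q p)

/-- The minimum over the cuts, for the schedule `p`. -/
noncomputable def minCutInfo (W : Network N X Y) (Q : Kernel (State N) (∀ i, X i))
    [IsMarkovKernel Q] (p : PMF (State N)) : ℝ≥0∞ :=
  ⨅ A : Finset (Fin N), cutInfo W Q p A

/-- `C'`: the supremum over the schedules of the minimum over the cuts. -/
noncomputable def fixedScheduleRate (W : Network N X Y) (Q : Kernel (State N) (∀ i, X i))
    [IsMarkovKernel Q] : ℝ≥0∞ :=
  ⨆ p : PMF (State N), minCutInfo W Q p

end

/-! ### Codes and capacity -/

section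

variable {N : ℕ} (X Y : Fin (N + 1) → Type*)
  [∀ i, MeasurableSpace (X i)] [∀ i, MeasurableSpace (Y i)]

/-- A code with `M` messages and block length `n`. In slot `t` the source sends a function of the
message, and relay `k` chooses its input and its state as a function of the outputs that it has
observed in the slots `0, …, t - 1`. The encoders are given for all `t`; only their
values at `t < n` are used. -/
structure Code (n M : ℕ) where
  source : Fin M → ℕ → X (Fin.last N)
  relay : ∀ (k : Fin N) (t : ℕ), (Fin t → Y k.castSucc) → X k.castSucc × Bool
  measurable_relay : ∀ k t, Measurable (relay k t)
  decode : (Fin n → Y (Fin.last N)) → Fin M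
  measurable_decode : Measurable decode

/-- Average input cost constraints (such as power constraints), one for each node. The cost
function `0` imposes no constraint. -/
structure InputConstraint where
  cost : ∀ i, X i → ℝ≥0∞
  measurable_cost : ∀ i, Measurable (cost i)
  budget : Fin (N + 1) → ℝ≥0∞

variable {X Y} {n M : ℕ}

/-- The relay states and the inputs in slot `t`, given the message and all earlier outputs. -/
def Code.step (c : Code X Y n M) (m : Fin M) (t : ℕ) (h : Fin t → ∀ i, Y i) :
    State N × (∀ i, X i) :=
  (fun k => (c.relay k t (fun j => h j k.castSucc)).2,
    Fin.lastCases (motive := X) (c.source m t)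
      (fun k => (c.relay k t (fun j => h j k.castSucc)).1))

theorem Code.measurable_step (c : Code X Y n M) (m : Fin M) (t : ℕ) :
    Measurable (c.step m t) := by
  have hr : ∀ k : Fin N, Measurable fun h : Fin t → ∀ i, Y i =>
      c.relay k t (fun j => h j k.castSucc) := fun k =>
    (c.measurable_relay k t).comp (by fun_prop)
  refine Measurable.prodMk (measurable_pi_iff.2 fun k => (hr k).snd) (measurable_pi_iff.2 ?_)
  intro i
  induction i using Fin.lastCases with
  | last => simp
  | cast k => simpa using (hr k).fst

/-- The law of the outputs in the first `t` slots, given the message: the outputs of a slot are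
drawn from the channel at the current states and inputs, independently of the past otherwise. -/
noncomputable def Code.outputLaw (c : Code X Y n M) (W : Network N X Y) (m : Fin M) :
    (t : ℕ) → Measure (Fin t → ∀ i, Y i)
  | 0 => Measure.dirac Fin.elim0
  | t + 1 => (c.outputLaw W m t ⊗ₘ (W.channel.comap (c.step m t) (c.measurable_step m t))).map
      (fun hy => Fin.snoc (α := fun _ => ∀ i, Y i) hy.1 hy.2)

/-- The probability of a decoding error for a uniformly distributed message. -/
noncomputable def Code.errorProb (c : Code X Y n M) (W : Network N X Y) : ℝ≥0∞ :=
  (∑ m : Fin M, c.outputLaw W m n {y | c.decode (fun t => y t (Fin.last N)) ≠ m}) / M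

/-- The code meets the input constraints: for each message and node, the expected cost of the `n`
inputs is at most `n` times the budget. -/
def Code.Admissible (c : Code X Y n M) (W : Network N X Y) (B : InputConstraint X) : Prop :=
  ∀ (m : Fin M) (i : Fin (N + 1)),
    ∑ t ∈ Finset.range n, ∫⁻ h, B.cost i ((c.step m t h).2 i) ∂(c.outputLaw W m t)
      ≤ n * B.budget i

/-- The rate `R`, in nats per channel use, is achievable: for every `ε > 0` and all large block
lengths `n` there is an admissible code with at least `exp (n R)` messages and error probability
at most `ε`. -/
def Achievable (W : Network N X Y) (B : InputConstraint X) (R : ℝ≥0) : Prop :=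
  ∀ ε : ℝ≥0∞, 0 < ε → ∃ n₀ : ℕ, ∀ n, n₀ ≤ n → ∃ (M : ℕ) (c : Code X Y n M),
    Real.exp (n * R) ≤ M ∧ c.Admissible W B ∧ c.errorProb W ≤ ε

/-- The capacity, in nats per channel use. -/
noncomputable def capacity (W : Network N X Y) (B : InputConstraint X) : ℝ≥0∞ :=
  ⨆ (R : ℝ≥0) (_ : Achievable W B R), (R : ℝ≥0∞)

end

end HalfDuplex

/-! The cut information is linear in the schedule: it averages, over the relay states, the
informations across the cut in one state (`cutInfo_eq_sum`). Finding the best schedule is thus a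
finite zero-sum game in which the opponent picks a cut. The bound `N + 1`, in place of the number `2
^ N` of cuts, comes from submodularity of each state's payoff in the cut.

Game (`exists_sparse_optimal`). Suppose first that the payoffs are strictly submodular. The cuts
that are worst for a given mixture then form a chain, so there are at most `N + 1` of them. At an
extreme point of the set of optimal mixtures, a dimension count bounds the number of active states
by the number of worst cuts. The general case follows by subtracting `ε * |A| ^ 2` from the payoffs
and using compactness of the set of sparse mixtures.

Submodularity (`stateCutInfo_submodular`). Fix a state and compare the true law of inputs and
outputs with the reference law under which all inputs and outputs are independent, with the same
marginals. By independence of the noises, the divergence of all inputs together with the outputs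
observed across `A` is a sum over these outputs, hence modular in `A`. By the chain rule it is also
`D A + stateCutInfo m C A`, where `D A` is the divergence of the inputs and outputs on the receiving
side of the cut. Since the reference law is a product, `D` is supermodular, so the information is
submodular.

The subtraction needs `D` to be finite. This is where half-duplex operation enters: the input and
output of a relay are independent of each other, so the divergence attached to that output is
bounded by the information across the cut formed by this relay alone. -/

namespace HalfDuplex

open MeasureTheory ProbabilityTheory InformationTheory
open scoped ENNReal NNReal

/-! ### Optimal mixed strategies against submodular payoffs -/

section Game

variable {ι : Type*} [Fintype ι] {N : ℕ}

/-- The payoff of the mixture `p` of the set functions `f s` in the worst case. -/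
noncomputable def worstPayoff (f : ι → Finset (Fin N) → ℝ) (p : ι → ℝ) : ℝ :=
  Finset.univ.inf' Finset.univ_nonempty fun A => ∑ s, p s * f s A

theorem worstPayoff_le (f : ι → Finset (Fin N) → ℝ) (p : ι → ℝ) (A : Finset (Fin N)) :
    worstPayoff f p ≤ ∑ s, p s * f s A :=
  Finset.inf'_le _ (Finset.mem_univ A)

theorem le_worstPayoff_iff {f : ι → Finset (Fin N) → ℝ} {p : ι → ℝ} {a : ℝ} :
    a ≤ worstPayoff f p ↔ ∀ A, a ≤ ∑ s, p s * f s A := by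
  simp [worstPayoff]

theorem lt_worstPayoff_iff {f : ι → Finset (Fin N) → ℝ} {p : ι → ℝ} {a : ℝ} :
    a < worstPayoff f p ↔ ∀ A, a < ∑ s, p s * f s A := by
  simp [worstPayoff]

theorem continuous_worstPayoff (f : ι → Finset (Fin N) → ℝ) : Continuous (worstPayoff f) :=
  Continuous.finset_inf'_apply _ fun A _ => by fun_prop

/-- The minimizers of a strictly submodular function form a chain. -/
theorem card_minimizers_le {F : Finset (Fin N) → ℝ} {v : ℝ} (hv : ∀ A, v ≤ F A)
    (hF : ∀ A B, ¬ A ⊆ B → ¬ B ⊆ A → F (A ∪ B) + F (A ∩ B) < F A + F B) :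
    (Finset.univ.filter fun A => F A = v).card ≤ N + 1 := by
  rw [← Finset.card_range (N + 1)]
  -- Cardinality is injective on a chain and takes only the values `0, …, N`. Distinct minimizers of
  -- equal cardinality would be incomparable, and strict submodularity would push the union or the
  -- intersection below `v`.
  refine Finset.card_le_card_of_injOn Finset.card ?_ ?_
  · intro A _
    have := A.card_le_univ
    simp only [Fintype.card_fin] at this
    simp only [Finset.coe_range, Set.mem_Iio]
    omega
  · intro A hA B hB hAB
    simp only [Finset.coe_filter, Finset.mem_univ, true_and, Set.mem_ofPred_eq] at hA hB
    have hAB : A.card = B.card := hAB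
    by_contra hne
    have h1 : ¬ A ⊆ B := fun h => hne (Finset.eq_of_subset_of_card_le h hAB.ge)
    have h2 : ¬ B ⊆ A := fun h => hne (Finset.eq_of_subset_of_card_le h hAB.le).symm
    have := hF A B h1 h2
    linarith [hv (A ∪ B), hv (A ∩ B)]

/-- A mixture that is optimal and extreme among the optimal ones has no more active elements than
there are sets where the worst case occurs. -/
theorem card_support_le_card_minimizers {f : ι → Finset (Fin N) → ℝ} {p : ι → ℝ}
    (hp : p ∈ ({p ∈ stdSimplex ℝ ι | ∀ q ∈ stdSimplex ℝ ι,
      worstPayoff f q ≤ worstPayoff f p}).extremePoints ℝ) :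
    (Finset.univ.filter fun s => p s ≠ 0).card ≤
      (Finset.univ.filter fun A => ∑ s, p s * f s A = worstPayoff f p).card := by
  classical
  obtain ⟨⟨hps, hpo⟩, hext⟩ := hp
  set v := worstPayoff f p with hv
  set U := Finset.univ.filter fun s => p s ≠ 0 with hU
  set T := Finset.univ.filter fun A => ∑ s, p s * f s A = v with hT
  by_contra! hlt
  -- A kernel element `(d, c)` is a direction of total mass zero, supported on the active elements,
  -- that changes the payoff at every tight set at the same rate `c`. The extra coordinate `c`
  -- balances the mass equation, so a nonzero one exists as soon as `T` is smaller than `U`.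
  let L : ((U → ℝ) × ℝ) →ₗ[ℝ] ((T → ℝ) × ℝ) :=
    { toFun := fun dc => (fun A => ∑ s, dc.1 s * f s A - dc.2, ∑ s, dc.1 s)
      map_add' := by
        intro a b
        ext <;> simp [add_mul, Finset.sum_add_distrib]; ring
      map_smul' := by
        intro r a
        ext <;> simp [mul_sub, Finset.mul_sum, mul_assoc] }
  have hker : LinearMap.ker L ≠ ⊥ := by
    apply LinearMap.ker_ne_bot_of_finrank_lt
    simpa using hlt
  obtain ⟨⟨d', c⟩, hmem, hne⟩ := (Submodule.ne_bot_iff _).1 hker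
  rw [LinearMap.mem_ker] at hmem
  have hd1 : ∀ A ∈ T, ∑ s : U, d' s * f s A = c := by
    intro A hA
    have := congrFun (congrArg Prod.fst hmem) ⟨A, hA⟩
    simpa [L, sub_eq_zero] using this
  have hd2 : ∑ s : U, d' s = 0 := by
    simpa [L] using congrArg Prod.snd hmem
  let d : ι → ℝ := fun s => if h : s ∈ U then d' ⟨s, h⟩ else 0
  have hsum : ∀ g : ι → ℝ, ∑ s, d s * g s = ∑ s : U, d' s * g s := by
    intro g
    rw [← Finset.sum_subset (Finset.subset_univ U), ← Finset.sum_coe_sort U]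
    · refine Finset.sum_congr rfl fun s _ => ?_
      simp [d]
    · intro s _ hs
      simp [d, hs]
  have hd0 : ∑ s, d s = 0 := by
    have := hsum fun _ => 1
    simp only [mul_one] at this
    rw [this, hd2]
  have hpay : ∀ (t : ℝ) A, ∑ s, (p s + t * d s) * f s A
      = ∑ s, p s * f s A + t * ∑ s, d s * f s A := by
    intro t A
    simp only [add_mul, Finset.sum_add_distrib, Finset.mul_sum, mul_assoc]
  -- A short move along `d` in either direction stays in the simplex and creates no new tight set.
  have hev : ∀ᶠ t in nhds (0 : ℝ), (∀ s, 0 ≤ p s + t * d s) ∧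
      ∀ A, A ∉ T → v < ∑ s, p s * f s A + t * ∑ s, d s * f s A := by
    refine Filter.Eventually.and ?_ ?_
    · rw [Filter.eventually_all]
      intro s
      by_cases hs : s ∈ U
      · have h0 : 0 < p s := lt_of_le_of_ne (hps.1 s) (Ne.symm (by simpa [hU] using hs))
        have hc : Continuous fun t : ℝ => p s + t * d s := by fun_prop
        have := (hc.tendsto 0).eventually (lt_mem_nhds (b := p s + 0 * d s) (by simpa))
        exact this.mono fun t ht => le_of_lt ht
      · refine Filter.Eventually.of_forall fun t => ?_
        simp [d, hs, hps.1 s]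
    · rw [Filter.eventually_all]
      intro A
      by_cases hA : A ∈ T
      · simp [hA]
      · have h0 : v < ∑ s, p s * f s A :=
          lt_of_le_of_ne (worstPayoff_le f p A) (Ne.symm (by simpa [hT] using hA))
        have hc : Continuous fun t : ℝ => ∑ s, p s * f s A + t * ∑ s, d s * f s A := by fun_prop
        have := (hc.tendsto 0).eventually
          (lt_mem_nhds (a := v) (b := ∑ s, p s * f s A + 0 * ∑ s, d s * f s A) (by simpa))
        exact this.mono fun t ht _ => ht
  obtain ⟨ε, hε, hball⟩ := Metric.eventually_nhds_iff.1 hev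
  have hgood : ∀ t : ℝ, |t| < ε → (fun s => p s + t * d s) ∈ stdSimplex ℝ ι ∧
      ∀ A, A ∉ T → v < ∑ s, p s * f s A + t * ∑ s, d s * f s A := by
    intro t ht
    have := hball (y := t) (by simpa [Real.dist_eq] using ht)
    refine ⟨⟨this.1, ?_⟩, this.2⟩
    rw [Finset.sum_add_distrib, ← Finset.mul_sum, hd0, hps.2]; simp
  have hTc : ∀ A ∈ T, ∑ s, d s * f s A = c := fun A hA => by rw [hsum, hd1 A hA]
  have hTv : ∀ A ∈ T, ∑ s, p s * f s A = v := fun A hA => by simpa [hT] using hA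
  -- If `c = 0`, both short moves remain optimal and `p` is their midpoint, so extremality forces `d
  -- = 0`. If `c ≠ 0`, moving in the direction of the sign of `c` raises every tight payoff, against
  -- optimality.
  by_cases hc : c = 0
  · have hopt : ∀ t : ℝ, |t| < ε → (fun s => p s + t * d s) ∈ {p ∈ stdSimplex ℝ ι |
        ∀ q ∈ stdSimplex ℝ ι, worstPayoff f q ≤ worstPayoff f p} := by
      intro t ht
      refine ⟨(hgood t ht).1, fun q hq => (hpo q hq).trans ?_⟩
      rw [le_worstPayoff_iff]
      intro A
      rw [hpay]
      by_cases hA : A ∈ T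
      · rw [hTc A hA, hTv A hA, hc]; simp
      · exact ((hgood t ht).2 A hA).le
    have habs : |ε / 2| < ε := by rw [abs_of_pos (by positivity)]; linarith
    have h1 := hopt (ε / 2) habs
    have h2 := hopt (-(ε / 2)) (by rwa [abs_neg])
    have heq := hext h1 h2 ⟨1 / 2, 1 / 2, by norm_num, by norm_num, by norm_num, by
      ext s; simp; ring⟩
    apply hne
    have hd' : d' = 0 := by
      ext ⟨s, hs⟩
      have := congrFun heq s
      have hds : d s = 0 := by
        have h3 : ε / 2 * d s = 0 := by linarith
        exact (mul_eq_zero.1 h3).resolve_left (by positivity)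
      simpa [d, hs] using hds
    simp [hd', hc]
  · have hpos : ∃ t : ℝ, |t| < ε ∧ 0 < t * c := by
      have hε2 : |ε / 2| < ε := by rw [abs_of_pos (by positivity)]; linarith
      rcases lt_or_gt_of_ne hc with h | h
      · exact ⟨-(ε / 2), by rwa [abs_neg], by nlinarith⟩
      · exact ⟨ε / 2, hε2, by positivity⟩
    obtain ⟨t, ht, htc⟩ := hpos
    have := hpo _ (hgood t ht).1
    refine absurd this (not_le.2 ?_)
    rw [lt_worstPayoff_iff]
    intro A
    rw [hpay]
    by_cases hA : A ∈ T
    · rw [hTc A hA, hTv A hA]; linarith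
    · exact (hgood t ht).2 A hA

/-- The optimal mixtures form a nonempty compact set, which has an extreme point. The mixed payoff
there is again strictly submodular, so `card_support_le_card_minimizers` and `card_minimizers_le`
combine. -/
theorem exists_sparse_optimal_of_strict [Nonempty ι] {f : ι → Finset (Fin N) → ℝ}
    (hf : ∀ s A B, ¬ A ⊆ B → ¬ B ⊆ A → f s (A ∪ B) + f s (A ∩ B) < f s A + f s B) :
    ∃ p ∈ stdSimplex ℝ ι, (Finset.univ.filter fun s => p s ≠ 0).card ≤ N + 1 ∧
      ∀ q ∈ stdSimplex ℝ ι, worstPayoff f q ≤ worstPayoff f p := by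
  classical
  have hcpt := isCompact_stdSimplex ℝ ι
  obtain ⟨p₀, hp₀, hmax⟩ := hcpt.exists_isMaxOn
    ⟨_, single_mem_stdSimplex ℝ (Classical.arbitrary ι)⟩ (continuous_worstPayoff f).continuousOn
  have hO : IsCompact {p ∈ stdSimplex ℝ ι | ∀ q ∈ stdSimplex ℝ ι,
      worstPayoff f q ≤ worstPayoff f p} := by
    have hcl : IsClosed {p : ι → ℝ | ∀ q ∈ stdSimplex ℝ ι, worstPayoff f q ≤ worstPayoff f p} := by
      simp only [Set.ofPred_forall]
      exact isClosed_iInter fun q => isClosed_iInter fun _ =>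
        isClosed_le continuous_const (continuous_worstPayoff f)
    exact hcpt.inter_right hcl
  obtain ⟨p, hp⟩ := hO.extremePoints_nonempty ⟨p₀, hp₀, fun q hq => hmax hq⟩
  refine ⟨p, hp.1.1, (card_support_le_card_minimizers hp).trans ?_, hp.1.2⟩
  refine card_minimizers_le (worstPayoff_le f p) fun A B hAB hBA => ?_
  rw [← Finset.sum_add_distrib, ← Finset.sum_add_distrib]
  -- One positive weight is enough to carry strictness over to the mixture.
  obtain ⟨s, hs⟩ : ∃ s, 0 < p s := by
    by_contra! h
    have : ∑ s, p s ≤ 0 := Finset.sum_nonpos fun s _ => h s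
    rw [hp.1.1.2] at this
    linarith
  refine Finset.sum_lt_sum (fun s _ => ?_) ⟨s, Finset.mem_univ s, ?_⟩
  · rw [← mul_add, ← mul_add]
    exact mul_le_mul_of_nonneg_left (hf s A B hAB hBA).le (hp.1.1.1 s)
  · rw [← mul_add, ← mul_add]
    exact mul_lt_mul_of_pos_left (hf s A B hAB hBA) hs

/-- Union and intersection have the same total cardinality as `A` and `B` but are more spread out,
and squaring is strictly convex. The gap is `2 * |A \ B| * |B \ A|`. -/
theorem sq_card_union_add_sq_card_inter_lt {A B : Finset (Fin N)} (hAB : ¬ A ⊆ B)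
    (hBA : ¬ B ⊆ A) :
    (A.card : ℝ) ^ 2 + (B.card : ℝ) ^ 2 < ((A ∪ B).card : ℝ) ^ 2 + ((A ∩ B).card : ℝ) ^ 2 := by
  have h : ((A ∪ B).card : ℝ) + (A ∩ B).card = A.card + B.card := by
    exact_mod_cast Finset.card_union_add_card_inter A B
  have h1 : ((A ∩ B).card : ℝ) < A.card := by
    exact_mod_cast Finset.card_lt_card
      ⟨Finset.inter_subset_left, fun h => hAB (Finset.subset_inter_iff.1 h).2⟩
  have h2 : ((A ∩ B).card : ℝ) < B.card := by
    exact_mod_cast Finset.card_lt_card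
      ⟨Finset.inter_subset_right, fun h => hBA (Finset.subset_inter_iff.1 h).1⟩
  have h3 : ((A ∪ B).card : ℝ) = A.card + B.card - (A ∩ B).card := by linarith
  rw [h3]
  nlinarith [mul_pos (sub_pos.2 h1) (sub_pos.2 h2)]

/-- Against submodular payoffs on the subsets of an `N`-element set, some optimal mixture has at
most `N + 1` active elements. -/
theorem exists_sparse_optimal [Nonempty ι] {f : ι → Finset (Fin N) → ℝ}
    (hf : ∀ s A B, f s (A ∪ B) + f s (A ∩ B) ≤ f s A + f s B) :
    ∃ p ∈ stdSimplex ℝ ι, (Finset.univ.filter fun s => p s ≠ 0).card ≤ N + 1 ∧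
      ∀ q ∈ stdSimplex ℝ ι, worstPayoff f q ≤ worstPayoff f p := by
  classical
  let g : ℝ → ι → Finset (Fin N) → ℝ := fun ε s A => f s A - ε * (A.card : ℝ) ^ 2
  have hg : ∀ ε : ℝ, 0 < ε → ∃ p ∈ stdSimplex ℝ ι,
      (Finset.univ.filter fun s => p s ≠ 0).card ≤ N + 1 ∧
      ∀ q ∈ stdSimplex ℝ ι, worstPayoff (g ε) q ≤ worstPayoff (g ε) p := by
    intro ε hε
    refine exists_sparse_optimal_of_strict fun s A B hAB hBA => ?_
    have h1 := hf s A B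
    have h2 := mul_lt_mul_of_pos_left (sq_card_union_add_sq_card_inter_lt hAB hBA) hε
    simp only [g]
    linarith
  have hgp : ∀ (ε : ℝ), ∀ p ∈ stdSimplex ℝ ι, ∀ A,
      ∑ s, p s * g ε s A = ∑ s, p s * f s A - ε * (A.card : ℝ) ^ 2 := by
    intro ε p hp A
    simp only [g, mul_sub, Finset.sum_sub_distrib]
    rw [← Finset.sum_mul, hp.2, one_mul]
  -- The sparse mixtures are a finite union of closed faces of the simplex, hence compact. The best
  -- mixture within `K` is then compared with the perturbed optima, so no convergent subsequence is
  -- needed.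
  let K : Set (ι → ℝ) := {p ∈ stdSimplex ℝ ι |
    (Finset.univ.filter fun s => p s ≠ 0).card ≤ N + 1}
  have hK : IsCompact K := by
    have : K = stdSimplex ℝ ι ∩ ⋃ U ∈ Finset.univ.filter (fun U : Finset ι => U.card ≤ N + 1),
        {p : ι → ℝ | ∀ s ∉ U, p s = 0} := by
      ext p
      simp only [K, Set.mem_inter_iff, Set.mem_ofPred_eq, Set.mem_iUnion, Finset.mem_filter,
        Finset.mem_univ, true_and, exists_prop]
      refine and_congr_right fun _ => ⟨fun h => ⟨_, h, fun s hs => by simpa using hs⟩, ?_⟩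
      rintro ⟨U, hU, h⟩
      refine (Finset.card_le_card fun s hs => ?_).trans hU
      by_contra hsU
      exact (Finset.mem_filter.1 hs).2 (h s hsU)
    rw [this]
    refine (isCompact_stdSimplex ℝ ι).inter_right (isClosed_biUnion_finset fun U _ => ?_)
    simp only [Set.ofPred_forall]
    exact isClosed_iInter fun s => isClosed_iInter fun _ =>
      isClosed_eq (continuous_apply s) continuous_const
  obtain ⟨p₁, hp₁, hc₁, -⟩ := hg 1 one_pos
  obtain ⟨p, hp, hmax⟩ := hK.exists_isMaxOn ⟨p₁, hp₁, hc₁⟩ (continuous_worstPayoff f).continuousOn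
  refine ⟨p, hp.1, hp.2, fun q hq => ?_⟩
  refine le_of_forall_pos_le_add fun δ hδ => ?_
  -- The penalty `ε * |A| ^ 2` is then at most `δ` for every set; the `+ 1` covers `N = 0`.
  set ε : ℝ := δ / ((N : ℝ) ^ 2 + 1) with hεdef
  have hε : 0 < ε := by positivity
  have hεδ : ε * (N : ℝ) ^ 2 ≤ δ := by
    rw [hεdef, div_mul_eq_mul_div, div_le_iff₀ (by positivity)]
    nlinarith
  obtain ⟨r, hr, hcr, hopt⟩ := hg ε hε
  have h1 : worstPayoff f q - δ ≤ worstPayoff (g ε) q := by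
    rw [le_worstPayoff_iff]
    intro A
    rw [hgp ε q hq]
    have h2 := worstPayoff_le f q A
    have hA : (A.card : ℝ) ≤ N := by
      exact_mod_cast A.card_le_univ.trans_eq (Fintype.card_fin N)
    have h3 : ε * (A.card : ℝ) ^ 2 ≤ ε * (N : ℝ) ^ 2 := by gcongr
    linarith
  have h2 : worstPayoff (g ε) r ≤ worstPayoff f r := by
    rw [le_worstPayoff_iff]
    intro A
    have := worstPayoff_le (g ε) r A
    rw [hgp ε r hr] at this
    have h3 : 0 ≤ ε * (A.card : ℝ) ^ 2 := by positivity
    linarith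
  have h3 : worstPayoff f r ≤ worstPayoff f p := hmax (show r ∈ K from ⟨hr, hcr⟩)
  linarith [hopt q hq]

end Game

/-! ### Kullback-Leibler divergence of the laws of random variables -/

section KullbackLeibler

variable {Ω α β γ : Type*} [MeasurableSpace α] [MeasurableSpace β] [MeasurableSpace γ]

/-- `T` is a measurable function of `U`. -/
def MeasurablyDetermined (T : Ω → α) (U : Ω → β) : Prop :=
  ∃ g : β → α, Measurable g ∧ ∀ ω, T ω = g (U ω)

theorem MeasurablyDetermined.refl (T : Ω → α) : MeasurablyDetermined T T :=
  ⟨id, measurable_id, fun _ => rfl⟩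

theorem MeasurablyDetermined.trans {T : Ω → α} {U : Ω → β} {V : Ω → γ}
    (h : MeasurablyDetermined T U) (h' : MeasurablyDetermined U V) : MeasurablyDetermined T V := by
  obtain ⟨g, hg, hT⟩ := h
  obtain ⟨g', hg', hU⟩ := h'
  exact ⟨g ∘ g', hg.comp hg', fun ω => by simp [hT, hU]⟩

theorem MeasurablyDetermined.prodMk {T : Ω → α} {U : Ω → β} {V : Ω → γ}
    (h : MeasurablyDetermined T V) (h' : MeasurablyDetermined U V) :
    MeasurablyDetermined (fun ω => (T ω, U ω)) V := by
  obtain ⟨g, hg, hT⟩ := h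
  obtain ⟨g', hg', hU⟩ := h'
  exact ⟨fun v => (g v, g' v), hg.prodMk hg', fun ω => by simp [hT, hU]⟩

theorem MeasurablyDetermined.prodMk_right_of_left {T : Ω → α} {U : Ω → β} {V : Ω → γ}
    (h : MeasurablyDetermined T U) : MeasurablyDetermined T (fun ω => (U ω, V ω)) :=
  h.trans ⟨Prod.fst, measurable_fst, fun _ => rfl⟩

theorem MeasurablyDetermined.prodMk_right_of_right {T : Ω → α} {U : Ω → β} {V : Ω → γ}
    (h : MeasurablyDetermined T V) : MeasurablyDetermined T (fun ω => (U ω, V ω)) :=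
  h.trans ⟨Prod.snd, measurable_snd, fun _ => rfl⟩

theorem MeasurablyDetermined.restrict {ι : Type*} {X : ι → Type*} [∀ i, MeasurableSpace (X i)]
    {f : Ω → ∀ i, X i} {V : Ω → γ} {A : Finset ι}
    (h : ∀ i ∈ A, MeasurablyDetermined (fun ω => f ω i) V) :
    MeasurablyDetermined (fun ω => A.restrict (f ω)) V := by
  choose g hg hf using h
  exact ⟨fun v i => g i i.2 v, measurable_pi_iff.2 fun i => hg i i.2, fun ω => by
    ext i; exact hf i i.2 ω⟩

theorem MeasurablyDetermined.apply_restrict {ι : Type*} {X : ι → Type*}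
    [∀ i, MeasurableSpace (X i)] (f : Ω → ∀ i, X i) {A : Finset ι} {i : ι} (hi : i ∈ A) :
    MeasurablyDetermined (fun ω => f ω i) (fun ω => A.restrict (f ω)) :=
  ⟨fun v => v ⟨i, hi⟩, measurable_pi_apply _, fun _ => rfl⟩

variable [MeasurableSpace Ω]

theorem klDiv_map_le_of_determined (P R : Measure Ω) [IsFiniteMeasure P] [IsFiniteMeasure R]
    {T : Ω → α} {U : Ω → β} (hU : Measurable U) (h : MeasurablyDetermined T U) :
    klDiv (P.map T) (R.map T) ≤ klDiv (P.map U) (R.map U) := by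
  obtain ⟨g, hg, hT⟩ := h
  obtain rfl : T = g ∘ U := funext hT
  rw [← Measure.map_map hg hU, ← Measure.map_map hg hU]
  exact klDiv_map_le _ _ hg

/-- Data processing in both directions. This permits regrouping the coordinates of a random vector
without explicit measurable equivalences. -/
theorem klDiv_map_eq_of_determined (P R : Measure Ω) [IsFiniteMeasure P] [IsFiniteMeasure R]
    {T : Ω → α} {U : Ω → β} (hT : Measurable T) (hU : Measurable U)
    (h : MeasurablyDetermined T U) (h' : MeasurablyDetermined U T) :
    klDiv (P.map T) (R.map T) = klDiv (P.map U) (R.map U) :=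
  le_antisymm (klDiv_map_le_of_determined P R hU h) (klDiv_map_le_of_determined P R hT h')

theorem klDiv_map_of_leftInverse (μ ν : Measure α) [IsFiniteMeasure μ] [IsFiniteMeasure ν]
    {g : α → β} {h : β → α} (hg : Measurable g) (hh : Measurable h)
    (hgh : Function.LeftInverse h g) : klDiv (μ.map g) (ν.map g) = klDiv μ ν := by
  have := klDiv_map_eq_of_determined μ ν (T := g) (U := id) hg measurable_id ⟨g, hg, fun _ => rfl⟩
    ⟨h, hh, fun ω => (hgh ω).symm⟩
  simpa using this

/-- The chain rule for the divergence from a product measure. -/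
theorem klDiv_map_prodMk_prod (P : Measure Ω) [IsProbabilityMeasure P]
    [StandardBorelSpace β] [Nonempty β]
    {U : Ω → α} {V : Ω → β} (hU : Measurable U) (hV : Measurable V)
    (ρ : Measure α) (σ : Measure β) [IsProbabilityMeasure ρ] [IsProbabilityMeasure σ] :
    klDiv (P.map fun ω => (U ω, V ω)) (ρ.prod σ)
      = klDiv (P.map U) ρ + klDiv (P.map fun ω => (U ω, V ω)) ((P.map U).prod σ) := by
  have := Measure.isProbabilityMeasure_map (μ := P) hU.aemeasurable
  rw [← compProd_map_condDistrib hV.aemeasurable, ← Measure.compProd_const,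
    ← Measure.compProd_const, klDiv_compProd_eq_add]

theorem klDiv_map_prodMk_prod_le_of_determined (P : Measure Ω) [IsProbabilityMeasure P]
    {T : Ω → α} {U : Ω → β} {V : Ω → γ} (hU : Measurable U) (hV : Measurable V)
    (σ : Measure γ) [IsProbabilityMeasure σ] (h : MeasurablyDetermined T U) :
    klDiv (P.map fun ω => (T ω, V ω)) ((P.map T).prod σ)
      ≤ klDiv (P.map fun ω => (U ω, V ω)) ((P.map U).prod σ) := by
  obtain ⟨g, hg, hT⟩ := h
  obtain rfl : T = g ∘ U := funext hT
  have := klDiv_map_le (P.map fun ω => (U ω, V ω)) ((P.map U).prod σ)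
    (hg.prodMap (measurable_id (α := γ)))
  rw [Measure.map_map (by fun_prop) (hU.prodMk hV)] at this
  refine le_of_eq_of_le ?_ this
  congr 1
  have h2 := Measure.map_prod_map (P.map U) σ hg (measurable_id (α := γ))
  rw [Measure.map_id, Measure.map_map hg hU] at h2
  exact h2

/-- Relative to a law `R` that makes `(E, F)` and `G` independent, divergence is supermodular. -/
theorem klDiv_map_supermodular (P R : Measure Ω) [IsProbabilityMeasure P] [IsProbabilityMeasure R]
    [StandardBorelSpace γ] [Nonempty γ]
    {E : Ω → α} {F : Ω → β} {G : Ω → γ} (hE : Measurable E) (hF : Measurable F)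
    (hG : Measurable G) (hind : IndepFun (fun ω => (E ω, F ω)) G R) :
    klDiv (P.map fun ω => (E ω, F ω)) (R.map fun ω => (E ω, F ω))
        + klDiv (P.map fun ω => (E ω, G ω)) (R.map fun ω => (E ω, G ω))
      ≤ klDiv (P.map fun ω => ((E ω, F ω), G ω)) (R.map fun ω => ((E ω, F ω), G ω))
        + klDiv (P.map E) (R.map E) := by
  have hEF : Measurable fun ω => (E ω, F ω) := hE.prodMk hF
  have hind' : IndepFun E G R := hind.comp measurable_fst measurable_id
  have := Measure.isProbabilityMeasure_map (μ := R) hEF.aemeasurable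
  have := Measure.isProbabilityMeasure_map (μ := R) hE.aemeasurable
  have := Measure.isProbabilityMeasure_map (μ := R) hG.aemeasurable
  have := Measure.isProbabilityMeasure_map (μ := P) hEF.aemeasurable
  have := Measure.isProbabilityMeasure_map (μ := P) hE.aemeasurable
  rw [(indepFun_iff_map_prod_eq_prod_map_map hEF.aemeasurable hG.aemeasurable).1 hind,
    (indepFun_iff_map_prod_eq_prod_map_map hE.aemeasurable hG.aemeasurable).1 hind',
    klDiv_map_prodMk_prod P hE hG, klDiv_map_prodMk_prod P hEF hG, ← add_assoc,
    add_right_comm (klDiv _ _) _ (klDiv (P.map E) (R.map E))]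
  -- After the chain rule, both sides share the divergences of `(E, F)` and of `E`. What remains is
  -- data processing: discarding `F` lowers the divergence from independence of `G`.
  refine add_le_add_right ?_ _
  exact klDiv_map_prodMk_prod_le_of_determined P hEF hG (R.map G)
    (MeasurablyDetermined.refl E).prodMk_right_of_left

/-- For observations that are independent given the input, the divergence from independence is
additive. -/
theorem klDiv_compProd_prod (m : Measure α) [IsProbabilityMeasure m] (K : Kernel α β)
    (W : Kernel α γ) [IsMarkovKernel K] [IsMarkovKernel W] (κ : Measure β) (σ : Measure γ)
    [IsProbabilityMeasure κ] [IsProbabilityMeasure σ] :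
    klDiv (m ⊗ₘ (K ×ₖ W)) (m.prod (κ.prod σ))
      = klDiv (m ⊗ₘ K) (m.prod κ) + klDiv (m ⊗ₘ W) (m.prod σ) := by
  have key : ∀ (K : Kernel α β) (W : Kernel α γ) [IsMarkovKernel K] [IsMarkovKernel W],
      (m ⊗ₘ (K ×ₖ W)).map (fun v => ((v.1, v.2.1), v.2.2))
        = (m ⊗ₘ K) ⊗ₘ (W.comap Prod.fst measurable_fst) := by
    intro K W _ _
    refine Measure.ext_of_lintegral _ fun f hf => ?_
    rw [lintegral_map hf (by fun_prop), Measure.lintegral_compProd (by fun_prop),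
      Measure.lintegral_compProd hf, Measure.lintegral_compProd (by fun_prop)]
    refine lintegral_congr fun a => ?_
    rw [Kernel.prod_apply, lintegral_prod _ (by fun_prop)]
    simp
  have key' : ∀ (K : Kernel α β) (W : Kernel α γ) [IsMarkovKernel K] [IsMarkovKernel W],
      ((m ⊗ₘ K) ⊗ₘ (W.comap Prod.fst measurable_fst)).map (fun v => ((v.1.1, v.2), v.1.2))
        = (m ⊗ₘ W) ⊗ₘ (K.comap Prod.fst measurable_fst) := by
    intro K W _ _
    refine Measure.ext_of_lintegral _ fun f hf => ?_
    rw [lintegral_map hf (by fun_prop), Measure.lintegral_compProd (by fun_prop),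
      Measure.lintegral_compProd hf, Measure.lintegral_compProd (by fun_prop),
      Measure.lintegral_compProd (by fun_prop)]
    refine lintegral_congr fun a => ?_
    simp only [Kernel.comap_apply]
    exact lintegral_lintegral_swap (by fun_prop)
  have hprod : m.prod (κ.prod σ) = m ⊗ₘ (Kernel.const α κ ×ₖ Kernel.const α σ) := by
    rw [Kernel.prod_const, Measure.compProd_const]
  rw [hprod, ← klDiv_map_of_leftInverse _ _ (g := fun v : α × β × γ => ((v.1, v.2.1), v.2.2))
    (h := fun v => (v.1.1, (v.1.2, v.2))) (by fun_prop) (by fun_prop) (fun _ => rfl), key, key,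
    klDiv_compProd_eq_add, Measure.compProd_const]
  congr 1
  have hc : (Kernel.const α σ).comap Prod.fst (measurable_fst (β := β))
      = Kernel.const (α × β) σ := rfl
  -- In the second term of the chain rule, the two observations are swapped. Both laws then end with
  -- the same kernel `K`, which contributes nothing.
  rw [← klDiv_map_of_leftInverse _ _ (g := fun v : (α × β) × γ => ((v.1.1, v.2), v.1.2))
    (h := fun v => ((v.1.1, v.2), v.1.2)) (by fun_prop) (by fun_prop) (fun _ => rfl), key', key',
    klDiv_compProd_left, Measure.compProd_const]

/-- The conditional divergence given a random variable with finitely many values. -/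
theorem klDiv_compProd_right_eq_sum {S : Type*} [Fintype S] [MeasurableSpace S]
    [DiscreteMeasurableSpace S] (μ : Measure S) [IsFiniteMeasure μ] (κ η : Kernel S α)
    [IsMarkovKernel κ] [IsMarkovKernel η] :
    klDiv (μ ⊗ₘ κ) (μ ⊗ₘ η) = ∑ s, μ {s} * klDiv (κ s) (η s) := by
  -- If absolute continuity holds on every atom of positive mass, the statewise densities glue to a
  -- joint density. Otherwise both sides are infinite. Null atoms drop out because `0 * ⊤ = 0`.
  by_cases hac : ∀ s, μ {s} ≠ 0 → κ s ≪ η s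
  · have hac' : ∀ᵐ s ∂μ, κ s ≪ η s := ae_iff_of_countable.2 hac
    let φ : S × α → ℝ≥0∞ := fun v => (κ v.1).rnDeriv (η v.1) v.2
    have hφ : Measurable φ :=
      measurable_from_prod_countable_right fun s => Measure.measurable_rnDeriv (κ s) (η s)
    have hd : μ ⊗ₘ κ = (μ ⊗ₘ η).withDensity φ := by
      ext A hA
      rw [Measure.compProd_apply hA, withDensity_apply _ hA, ← lintegral_indicator hA,
        Measure.lintegral_compProd (hφ.indicator hA)]
      refine lintegral_congr_ae (hac'.mono fun s hs => ?_)
      have hAs : MeasurableSet (Prod.mk s ⁻¹' A) := measurable_prodMk_left hA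
      dsimp only
      rw [← Measure.setLIntegral_rnDeriv hs, ← lintegral_indicator hAs]
      rfl
    have hrn : (μ ⊗ₘ κ).rnDeriv (μ ⊗ₘ η) =ᵐ[μ ⊗ₘ η] φ := by
      rw [hd]
      exact Measure.rnDeriv_withDensity _ hφ
    rw [klDiv_eq_lintegral_klFun_of_ac (Measure.AbsolutelyContinuous.compProd_right hac'),
      lintegral_congr_ae (hrn.mono fun x hx => by rw [hx] :
        _ =ᵐ[μ ⊗ₘ η] fun x => ENNReal.ofReal (klFun (φ x).toReal)),
      Measure.lintegral_compProd (by fun_prop), lintegral_fintype]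
    refine Finset.sum_congr rfl fun s _ => ?_
    by_cases hs : μ {s} = 0
    · simp [hs]
    · rw [klDiv_eq_lintegral_klFun_of_ac (hac s hs), mul_comm]
  · have hnac : ¬ μ ⊗ₘ κ ≪ μ ⊗ₘ η := by
      rw [Measure.absolutelyContinuous_compProd_right_iff, ae_iff_of_countable]
      exact hac
    push Not at hac
    obtain ⟨s, hs, hs'⟩ := hac
    rw [klDiv_of_not_ac hnac, eq_comm, ENNReal.sum_eq_top]
    exact ⟨s, Finset.mem_univ s, by rw [klDiv_of_not_ac hs', ENNReal.mul_top hs]⟩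

/-- Independence of pairs under a product measure. -/
theorem indepFun_prodMk_prodMk_prod {Ω' α' β' : Type*} [MeasurableSpace Ω'] [MeasurableSpace α']
    [MeasurableSpace β'] {μ : Measure Ω} {μ' : Measure Ω'} [IsProbabilityMeasure μ]
    [IsProbabilityMeasure μ'] {U : Ω → α} {V : Ω → β} {U' : Ω' → α'} {V' : Ω' → β'}
    (hU : Measurable U) (hV : Measurable V) (hU' : Measurable U') (hV' : Measurable V')
    (h : IndepFun U V μ) (h' : IndepFun U' V' μ') :
    IndepFun (fun ω : Ω × Ω' => (U ω.1, U' ω.2)) (fun ω => (V ω.1, V' ω.2)) (μ.prod μ') := by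
  have := Measure.isProbabilityMeasure_map (μ := μ) hU.aemeasurable
  have := Measure.isProbabilityMeasure_map (μ := μ) hV.aemeasurable
  have := Measure.isProbabilityMeasure_map (μ := μ') hU'.aemeasurable
  have := Measure.isProbabilityMeasure_map (μ := μ') hV'.aemeasurable
  rw [indepFun_iff_map_prod_eq_prod_map_map (by fun_prop) (by fun_prop)]
  have h1 := Measure.map_prod_map μ μ' hU hU'
  have h2 := Measure.map_prod_map μ μ' hV hV'
  simp only [Prod.map_def] at h1 h2
  rw [← h1, ← h2]
  refine Measure.ext_of_lintegral _ fun f hf => ?_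
  have hUV := (indepFun_iff_map_prod_eq_prod_map_map hU.aemeasurable hV.aemeasurable).1 h
  have hUV' := (indepFun_iff_map_prod_eq_prod_map_map hU'.aemeasurable hV'.aemeasurable).1 h'
  have h3 := Measure.map_prod_map μ μ' (hU.prodMk hV) (hU'.prodMk hV')
  rw [hUV, hUV'] at h3
  -- Tonelli exchanges the two middle factors of the fourfold product.
  have h4 : ∫⁻ z, f ((z.1.1, z.2.1), (z.1.2, z.2.2)) ∂(((μ.map U).prod (μ.map V)).prod
      ((μ'.map U').prod (μ'.map V'))) = ∫⁻ z, f z ∂(((μ.map U).prod (μ'.map U')).prod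
      ((μ.map V).prod (μ'.map V'))) := by
    rw [lintegral_prod _ (by fun_prop), lintegral_prod _ (by fun_prop),
      lintegral_prod _ (by fun_prop), lintegral_prod _ (by fun_prop)]
    refine lintegral_congr fun a => ?_
    calc _ = ∫⁻ b, ∫⁻ a', ∫⁻ b', f ((a, a'), (b, b')) ∂(μ'.map V') ∂(μ'.map U') ∂(μ.map V) := by
          refine lintegral_congr fun b => ?_
          rw [lintegral_prod _ (by fun_prop)]
      _ = ∫⁻ a', ∫⁻ b, ∫⁻ b', f ((a, a'), (b, b')) ∂(μ'.map V') ∂(μ.map V) ∂(μ'.map U') :=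
          lintegral_lintegral_swap (by fun_prop)
      _ = _ := by
          refine lintegral_congr fun a' => ?_
          rw [lintegral_prod _ (by fun_prop)]
  rw [← h4, h3, lintegral_map hf (by fun_prop), lintegral_map (by fun_prop) (by fun_prop)]
  rfl

end KullbackLeibler

/-! ### Submodularity of the cut information in one state -/

section Family

variable {Ω α β γ : Type*} [MeasurableSpace α] [MeasurableSpace β] [MeasurableSpace γ]
  [MeasurableSpace Ω]

theorem indepFun_of_determined {R : Measure Ω} {T : Ω → α} {U : Ω → β} {V : Ω → γ}
    (hUV : IndepFun U V R) (h : MeasurablyDetermined T U) : IndepFun T V R := by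
  obtain ⟨g, hg, hT⟩ := h
  obtain rfl : T = g ∘ U := funext hT
  exact hUV.comp hg measurable_id

theorem map_eq_of_determined {P R : Measure Ω} {T : Ω → α} {U : Ω → β}
    (hU : Measurable U) (h : MeasurablyDetermined T U) (hPR : P.map U = R.map U) :
    P.map T = R.map T := by
  obtain ⟨g, hg, hT⟩ := h
  obtain rfl : T = g ∘ U := funext hT
  rw [← Measure.map_map hg hU, ← Measure.map_map hg hU, hPR]

theorem map_compProd_fst_comp_snd (m : Measure α) [SFinite m] (C : Kernel α β)
    [IsMarkovKernel C] {g : β → γ} (hg : Measurable g) :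
    (m ⊗ₘ C).map (fun ω => (ω.1, g ω.2)) = m ⊗ₘ (C.map g) := by
  have := Kernel.IsMarkovKernel.map C hg
  refine Measure.ext_of_lintegral _ fun f hf => ?_
  rw [lintegral_map hf (by fun_prop), Measure.lintegral_compProd (by fun_prop),
    Measure.lintegral_compProd hf]
  refine lintegral_congr fun a => ?_
  rw [Kernel.map_apply _ hg, lintegral_map (by fun_prop) hg]

theorem map_prod_fst_comp_snd (m : Measure α) [SFinite m] (π : Measure β) [IsProbabilityMeasure π]
    {g : β → γ} (hg : Measurable g) :
    (m.prod π).map (fun ω => (ω.1, g ω.2)) = m.prod (π.map g) := by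
  have := Measure.isProbabilityMeasure_map (μ := π) hg.aemeasurable
  have := Measure.map_prod_map m π measurable_id hg
  rw [Measure.map_id] at this
  exact this.symm

variable {ι : Type*} [Fintype ι] {X : ι → Type*} [∀ i, MeasurableSpace (X i)]

theorem iIndepFun_apply_of_eq_pi {m : Measure (∀ i, X i)} [IsProbabilityMeasure m]
    (hm : m = Measure.pi fun i => m.map fun x => x i) :
    iIndepFun (fun (i : ι) (x : ∀ i, X i) => x i) m := by
  rw [iIndepFun_iff_map_fun_eq_pi_map fun i => (measurable_pi_apply i).aemeasurable]
  rw [← hm]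
  exact Measure.map_id

theorem indepFun_restrict_of_eq_pi {m : Measure (∀ i, X i)} [IsProbabilityMeasure m]
    (hm : m = Measure.pi fun i => m.map fun x => x i) {S T : Finset ι} (h : Disjoint S T) :
    IndepFun S.restrict T.restrict m :=
  (iIndepFun_apply_of_eq_pi hm).indepFun_finset S T h fun i => measurable_pi_apply i

theorem indepFun_restrict_apply_of_eq_pi {m : Measure (∀ i, X i)} [IsProbabilityMeasure m]
    (hm : m = Measure.pi fun i => m.map fun x => x i) {S : Finset ι} {i : ι} (h : i ∉ S) :
    IndepFun S.restrict (fun x => x i) m := by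
  have := indepFun_restrict_of_eq_pi hm (Finset.disjoint_singleton_right.2 h)
  exact this.comp measurable_id
    (measurable_pi_apply (⟨i, Finset.mem_singleton_self i⟩ : ({i} : Finset ι)))

end Family

/-! ### Decomposition of the divergence across a cut in one state -/

section OneState

variable {N : ℕ} {X Y : Fin (N + 1) → Type*}
  [∀ i, MeasurableSpace (X i)] [∀ i, MeasurableSpace (Y i)]

/-- The inputs of the relays of `A` and the outputs at these relays and at the destination. -/
def cutSide (A : Finset (Fin N)) (ω : (∀ i, X i) × (∀ i, Y i)) :
    (∀ i : relayNodes A, X i) × (∀ i : ↥(insert (Fin.last N) (relayNodes A)), Y i) :=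
  ((relayNodes A).restrict ω.1, (insert (Fin.last N) (relayNodes A)).restrict ω.2)

/-- The inputs of the nodes outside `A`. -/
def cutInput (A : Finset (Fin N)) (ω : (∀ i, X i) × (∀ i, Y i)) :
    ∀ i : ↥(relayNodes A)ᶜ, X i :=
  ((relayNodes A)ᶜ).restrict ω.1

@[fun_prop]
theorem measurable_cutSide (A : Finset (Fin N)) : Measurable (cutSide (X := X) (Y := Y) A) :=
  ((Finset.measurable_restrict _).comp measurable_fst).prodMk
    ((Finset.measurable_restrict _).comp measurable_snd)

@[fun_prop]
theorem measurable_cutInput (A : Finset (Fin N)) : Measurable (cutInput (X := X) (Y := Y) A) :=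
  (Finset.measurable_restrict _).comp measurable_fst

/-- The information across the cut `A` for a given state: `m` is the input law and `C` the channel
in this state. -/
noncomputable def stateCutInfo (m : Measure (∀ i, X i)) (C : Kernel (∀ i, X i) (∀ i, Y i))
    (A : Finset (Fin N)) : ℝ≥0∞ :=
  klDiv ((m ⊗ₘ C).map fun ω => (cutSide A ω, cutInput A ω))
    (((m ⊗ₘ C).map (cutSide A)).prod (m.map ((relayNodes A)ᶜ).restrict))

/-- The law of independent outputs with the marginals of the output law. -/
noncomputable def outputProduct (m : Measure (∀ i, X i)) (C : Kernel (∀ i, X i) (∀ i, Y i)) :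
    Measure (∀ i, Y i) :=
  Measure.pi fun i => (m ⊗ₘ C).map fun ω => ω.2 i

variable (m : Measure (∀ i, X i)) [IsProbabilityMeasure m] (C : Kernel (∀ i, X i) (∀ i, Y i))
  [IsMarkovKernel C]

instance isProbabilityMeasure_map_snd_apply (i : Fin (N + 1)) :
    IsProbabilityMeasure ((m ⊗ₘ C).map fun ω => ω.2 i) :=
  Measure.isProbabilityMeasure_map (by fun_prop)

instance : IsProbabilityMeasure (outputProduct m C) := by
  unfold outputProduct
  infer_instance

theorem outputProduct_map_apply (i : Fin (N + 1)) :
    (outputProduct m C).map (fun y => y i) = (m ⊗ₘ C).map fun ω => ω.2 i :=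
  (measurePreserving_eval _ i).map_eq

theorem outputProduct_eq_pi :
    outputProduct m C = Measure.pi fun i => (outputProduct m C).map fun y => y i := by
  simp only [outputProduct_map_apply]
  rfl

variable {m C}

theorem indepFun_restrict_prod (hm : m = Measure.pi fun i => m.map fun x => x i)
    {S T S' T' : Finset (Fin (N + 1))} (h : Disjoint S T) (h' : Disjoint S' T') :
    IndepFun (fun ω : (∀ i, X i) × (∀ i, Y i) => (S.restrict ω.1, S'.restrict ω.2))
      (fun ω => (T.restrict ω.1, T'.restrict ω.2)) (m.prod (outputProduct m C)) :=
  indepFun_prodMk_prodMk_prod (Finset.measurable_restrict _) (Finset.measurable_restrict _)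
    (Finset.measurable_restrict _) (Finset.measurable_restrict _)
    (indepFun_restrict_of_eq_pi hm h) (indepFun_restrict_of_eq_pi (outputProduct_eq_pi m C) h')

variable (m) in
/-- Independent noises make the divergence additive over the outputs. -/
theorem klDiv_restrict_eq_sum (hC : ∀ x, C x = Measure.pi fun i => (C x).map fun y => y i)
    (T : Finset (Fin (N + 1))) :
    klDiv ((m ⊗ₘ C).map fun ω => (ω.1, T.restrict ω.2))
        ((m.prod (outputProduct m C)).map fun ω => (ω.1, T.restrict ω.2))
      = ∑ i ∈ T, klDiv ((m ⊗ₘ C).map fun ω => (ω.1, ω.2 i))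
        ((m.prod (outputProduct m C)).map fun ω => (ω.1, ω.2 i)) := by
  induction T using Finset.induction_on with
  | empty =>
    rw [Finset.sum_empty]
    have h : (m ⊗ₘ C).map (fun ω => (ω.1, (∅ : Finset (Fin (N + 1))).restrict ω.2))
        = (m.prod (outputProduct m C)).map
          (fun ω => (ω.1, (∅ : Finset (Fin (N + 1))).restrict ω.2)) := by
      refine map_eq_of_determined (U := Prod.fst) measurable_fst
        ((MeasurablyDetermined.refl _).prodMk (MeasurablyDetermined.restrict (by simp))) ?_
      rw [← Measure.fst, ← Measure.fst, Measure.fst_compProd, Measure.fst_prod]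
    rw [h]
    have : IsFiniteMeasure ((m.prod (outputProduct m C)).map
          (fun ω => (ω.1, (∅ : Finset (Fin (N + 1))).restrict ω.2))) := inferInstance
    exact klDiv_self _
  | insert i T hi ih =>
    rw [Finset.sum_insert hi, ← ih, add_comm (klDiv _ _)]
    have hT : Measurable (T.restrict : (∀ i, Y i) → _) := Finset.measurable_restrict _
    have hi' : Measurable fun y : (∀ i, Y i) => y i := measurable_pi_apply i
    have hins : Measurable ((insert i T).restrict : (∀ i, Y i) → _) := Finset.measurable_restrict _
    rw [klDiv_map_eq_of_determined (m ⊗ₘ C) (m.prod (outputProduct m C))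
      (T := fun ω => (ω.1, (insert i T).restrict ω.2))
      (U := fun ω => (ω.1, (T.restrict ω.2, ω.2 i))) (by fun_prop) (by fun_prop)]
    · have hTi : Measurable fun y : (∀ i, Y i) => (T.restrict y, y i) := by fun_prop
      rw [map_compProd_fst_comp_snd m C hT, map_compProd_fst_comp_snd m C hi',
        map_compProd_fst_comp_snd m C hTi, map_prod_fst_comp_snd m _ hT,
        map_prod_fst_comp_snd m _ hi', map_prod_fst_comp_snd m _ hTi,
        (indepFun_iff_map_prod_eq_prod_map_map hT.aemeasurable hi'.aemeasurable).1
          (indepFun_restrict_apply_of_eq_pi (outputProduct_eq_pi m C) hi)]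
      -- Independence of the noises splits off the output `i`; `klDiv_compProd_prod` then separates
      -- its divergence.
      have hK : C.map (fun y => (T.restrict y, y i)) = C.map T.restrict ×ₖ C.map fun y => y i := by
        have := Kernel.IsMarkovKernel.map C hT
        have := Kernel.IsMarkovKernel.map C hi'
        ext1 x
        rw [Kernel.map_apply _ hTi, Kernel.prod_apply, Kernel.map_apply _ hT,
          Kernel.map_apply _ hi']
        exact (indepFun_iff_map_prod_eq_prod_map_map hT.aemeasurable hi'.aemeasurable).1
          (indepFun_restrict_apply_of_eq_pi (hC x) hi)
      have := Kernel.IsMarkovKernel.map C hT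
      have := Kernel.IsMarkovKernel.map C hi'
      have := Measure.isProbabilityMeasure_map (μ := outputProduct m C) hT.aemeasurable
      have := Measure.isProbabilityMeasure_map (μ := outputProduct m C) hi'.aemeasurable
      rw [hK, klDiv_compProd_prod]
    · refine (MeasurablyDetermined.refl _).prodMk_right_of_left.prodMk
        (MeasurablyDetermined.restrict fun j hj => ?_)
      rcases Finset.mem_insert.1 hj with rfl | hj
      · exact (MeasurablyDetermined.refl _).prodMk_right_of_right.prodMk_right_of_right
      · exact (MeasurablyDetermined.apply_restrict Prod.snd
          hj).prodMk_right_of_left.prodMk_right_of_right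
    · refine (MeasurablyDetermined.refl _).prodMk_right_of_left.prodMk
        ((MeasurablyDetermined.restrict fun j hj => ?_).prodMk ?_)
      · exact (MeasurablyDetermined.apply_restrict Prod.snd
          (Finset.mem_insert_of_mem hj)).prodMk_right_of_right
      · exact (MeasurablyDetermined.apply_restrict Prod.snd
          (Finset.mem_insert_self i T)).prodMk_right_of_right

theorem determined_cutSide_of_forall {γ : Type*} [MeasurableSpace γ] {A : Finset (Fin N)}
    {V : (∀ i, X i) × (∀ i, Y i) → γ}
    (h : ∀ i ∈ relayNodes A, MeasurablyDetermined (fun ω => ω.1 i) V)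
    (h' : ∀ i ∈ insert (Fin.last N) (relayNodes A), MeasurablyDetermined (fun ω => ω.2 i) V) :
    MeasurablyDetermined (cutSide A) V :=
  (MeasurablyDetermined.restrict (f := Prod.fst) h).prodMk
    (MeasurablyDetermined.restrict (f := Prod.snd) h')

theorem input_determined_cutSide {A : Finset (Fin N)} {i : Fin (N + 1)} (hi : i ∈ relayNodes A) :
    MeasurablyDetermined (fun ω => ω.1 i) (cutSide (X := X) (Y := Y) A) :=
  (MeasurablyDetermined.apply_restrict Prod.fst hi).prodMk_right_of_left

theorem output_determined_cutSide {A : Finset (Fin N)} {i : Fin (N + 1)}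
    (hi : i ∈ insert (Fin.last N) (relayNodes A)) :
    MeasurablyDetermined (fun ω => ω.2 i) (cutSide (X := X) (Y := Y) A) :=
  (MeasurablyDetermined.apply_restrict Prod.snd hi).prodMk_right_of_right

variable [∀ i, StandardBorelSpace (X i)] [∀ i, Nonempty (X i)]

/-- All inputs together with the observed outputs amount to the pair `(cutSide A, cutInput A)`. Its
components are independent under the reference law, because the inputs are, so the chain rule
applies and its second term is the cut information. -/
theorem klDiv_cut_add_stateCutInfo (hm : m = Measure.pi fun i => m.map fun x => x i)
    (A : Finset (Fin N)) :
    klDiv ((m ⊗ₘ C).map fun ω => (ω.1, (insert (Fin.last N) (relayNodes A)).restrict ω.2))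
        ((m.prod (outputProduct m C)).map
          fun ω => (ω.1, (insert (Fin.last N) (relayNodes A)).restrict ω.2))
      = klDiv ((m ⊗ₘ C).map (cutSide A)) ((m.prod (outputProduct m C)).map (cutSide A))
        + stateCutInfo m C A := by
  have hind : IndepFun (cutSide A) (cutInput A) (m.prod (outputProduct m C)) := by
    have := indepFun_restrict_prod (C := C) hm (S := relayNodes A) (T := (relayNodes A)ᶜ)
      (S' := insert (Fin.last N) (relayNodes A)) (T' := ∅) disjoint_compl_right
      (Finset.disjoint_empty_right _)
    exact this.comp measurable_id measurable_fst
  have hlaw : (m.prod (outputProduct m C)).map (cutInput A) = m.map ((relayNodes A)ᶜ).restrict := by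
    have : cutInput (X := X) (Y := Y) A = ((relayNodes A)ᶜ).restrict ∘ Prod.fst := rfl
    rw [this, ← Measure.map_map (Finset.measurable_restrict _) measurable_fst, ← Measure.fst,
      Measure.fst_prod]
  have := Measure.isProbabilityMeasure_map (μ := m.prod (outputProduct m C))
    (measurable_cutSide A).aemeasurable
  have := Measure.isProbabilityMeasure_map (μ := m.prod (outputProduct m C))
    (measurable_cutInput A).aemeasurable
  rw [klDiv_map_eq_of_determined _ _
      (T := fun ω => (ω.1, (insert (Fin.last N) (relayNodes A)).restrict ω.2))
      (U := fun ω => (cutSide A ω, cutInput A ω)) (by fun_prop) (by fun_prop),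
    (indepFun_iff_map_prod_eq_prod_map_map (by fun_prop) (by fun_prop)).1 hind,
    klDiv_map_prodMk_prod _ (measurable_cutSide A) (measurable_cutInput A), hlaw]
  · rfl
  · refine MeasurablyDetermined.prodMk ?_ (MeasurablyDetermined.restrict fun i hi =>
      (output_determined_cutSide hi).prodMk_right_of_left)
    have h : MeasurablyDetermined (fun ω => Finset.univ.restrict ω.1)
        (fun ω : (∀ i, X i) × (∀ i, Y i) => (cutSide A ω, cutInput A ω)) := by
      refine MeasurablyDetermined.restrict (f := Prod.fst) fun i _ => ?_
      by_cases hi : i ∈ relayNodes A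
      · exact (input_determined_cutSide hi).prodMk_right_of_left
      · exact (MeasurablyDetermined.apply_restrict (A := (relayNodes A)ᶜ) Prod.fst
          (by simpa using hi)).prodMk_right_of_right
    exact MeasurablyDetermined.trans
      ⟨fun v i => v ⟨i, Finset.mem_univ i⟩, by fun_prop, fun ω => rfl⟩ h
  · have hin : ∀ i, MeasurablyDetermined (fun ω => ω.1 i) (fun ω : (∀ i, X i) × (∀ i, Y i) =>
        (ω.1, (insert (Fin.last N) (relayNodes A)).restrict ω.2)) := fun i =>
      MeasurablyDetermined.prodMk_right_of_left ⟨fun x => x i, by fun_prop, fun _ => rfl⟩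
    refine (determined_cutSide_of_forall (fun i _ => hin i) fun i hi => ?_).prodMk
      (MeasurablyDetermined.restrict fun i _ => hin i)
    exact (MeasurablyDetermined.apply_restrict Prod.snd hi).prodMk_right_of_right

variable [∀ i, StandardBorelSpace (Y i)] [∀ i, Nonempty (Y i)]

/-- This is `klDiv_map_supermodular` with `E` the side of `A ∩ B` and `F`, `G` the data of the
relays in `A \ B` and `B \ A`. Disjoint groups of coordinates are independent under the reference
law. -/
theorem klDiv_cutSide_supermodular (hm : m = Measure.pi fun i => m.map fun x => x i)
    (A B : Finset (Fin N)) :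
    klDiv ((m ⊗ₘ C).map (cutSide A)) ((m.prod (outputProduct m C)).map (cutSide A))
        + klDiv ((m ⊗ₘ C).map (cutSide B)) ((m.prod (outputProduct m C)).map (cutSide B))
      ≤ klDiv ((m ⊗ₘ C).map (cutSide (A ∪ B)))
          ((m.prod (outputProduct m C)).map (cutSide (A ∪ B)))
        + klDiv ((m ⊗ₘ C).map (cutSide (A ∩ B)))
          ((m.prod (outputProduct m C)).map (cutSide (A ∩ B))) := by
  -- The destination output is left out of `D`: it belongs to the common part `cutSide (A ∩ B)`, and
  -- repeating it in `D (B \ A)` would spoil independence.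
  let D (A : Finset (Fin N)) (ω : (∀ i, X i) × (∀ i, Y i)) :
      (∀ i : relayNodes A, X i) × (∀ i : relayNodes A, Y i) :=
    ((relayNodes A).restrict ω.1, (relayNodes A).restrict ω.2)
  have hD : ∀ A, Measurable (D A) := fun A =>
    ((Finset.measurable_restrict _).comp measurable_fst).prodMk
      ((Finset.measurable_restrict _).comp measurable_snd)
  have hDin : ∀ {A : Finset (Fin N)} {i}, i ∈ relayNodes A →
      MeasurablyDetermined (fun ω => ω.1 i) (D A) := fun hi =>
    (MeasurablyDetermined.apply_restrict Prod.fst hi).prodMk_right_of_left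
  have hDout : ∀ {A : Finset (Fin N)} {i}, i ∈ relayNodes A →
      MeasurablyDetermined (fun ω => ω.2 i) (D A) := fun hi =>
    (MeasurablyDetermined.apply_restrict Prod.snd hi).prodMk_right_of_right
  have hsplit : ∀ A B : Finset (Fin N), ∀ i ∈ relayNodes A,
      i ∈ relayNodes (A ∩ B) ∨ i ∈ relayNodes (A \ B) := by
    intro A B i hi
    simp only [relayNodes, Finset.mem_map, Finset.mem_inter, Finset.mem_sdiff] at hi ⊢
    obtain ⟨k, hk, rfl⟩ := hi
    by_cases hB : k ∈ B
    · exact Or.inl ⟨k, ⟨hk, hB⟩, rfl⟩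
    · exact Or.inr ⟨k, ⟨hk, hB⟩, rfl⟩
  have hmono : ∀ {A B : Finset (Fin N)}, A ⊆ B → relayNodes A ⊆ relayNodes B :=
    fun h => Finset.map_subset_map.2 h
  have hsideMono : ∀ {A B : Finset (Fin N)}, A ⊆ B →
      MeasurablyDetermined (cutSide (X := X) (Y := Y) A) (cutSide B) := fun h =>
    determined_cutSide_of_forall (fun i hi => input_determined_cutSide (hmono h hi)) fun i hi =>
      output_determined_cutSide (Finset.insert_subset_insert _ (hmono h) hi)
  have hDmono : ∀ {A B : Finset (Fin N)}, A ⊆ B →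
      MeasurablyDetermined (D A) (cutSide (X := X) (Y := Y) B) := fun h =>
    (MeasurablyDetermined.restrict (f := Prod.fst) fun i hi =>
      input_determined_cutSide (hmono h hi)).prodMk
    (MeasurablyDetermined.restrict (f := Prod.snd) fun i hi =>
      output_determined_cutSide (Finset.mem_insert_of_mem (hmono h hi)))
  have hside : ∀ A B : Finset (Fin N), MeasurablyDetermined (cutSide (X := X) (Y := Y) A)
      (fun ω => (cutSide (A ∩ B) ω, D (A \ B) ω)) := by
    refine fun A B => determined_cutSide_of_forall (fun i hi => ?_) fun i hi => ?_
    · rcases hsplit A B i hi with h | h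
      · exact (input_determined_cutSide h).prodMk_right_of_left
      · exact (hDin h).prodMk_right_of_right
    · rcases Finset.mem_insert.1 hi with rfl | hi
      · exact (output_determined_cutSide (Finset.mem_insert_self _ _)).prodMk_right_of_left
      rcases hsplit A B i hi with h | h
      · exact (output_determined_cutSide (Finset.mem_insert_of_mem h)).prodMk_right_of_left
      · exact (hDout h).prodMk_right_of_right
  have hA : MeasurablyDetermined (fun ω => (cutSide (X := X) (Y := Y) (A ∩ B) ω, D (A \ B) ω))
      (cutSide A) :=
    (hsideMono Finset.inter_subset_left).prodMk (hDmono Finset.sdiff_subset)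
  have hB : MeasurablyDetermined (fun ω => (cutSide (X := X) (Y := Y) (A ∩ B) ω, D (B \ A) ω))
      (cutSide B) :=
    (hsideMono Finset.inter_subset_right).prodMk (hDmono Finset.sdiff_subset)
  have hBA := hside B A
  rw [Finset.inter_comm] at hBA
  have hU : MeasurablyDetermined (cutSide (X := X) (Y := Y) (A ∪ B))
      (fun ω => ((cutSide (A ∩ B) ω, D (A \ B) ω), D (B \ A) ω)) := by
    have h := hside (A ∪ B) A
    rw [Finset.union_inter_cancel_left, Finset.union_sdiff_left] at h
    refine h.trans ((hside A B).prodMk_right_of_left.prodMk ?_)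
    exact (MeasurablyDetermined.refl _).prodMk_right_of_right
  have hU' : MeasurablyDetermined
      (fun ω => ((cutSide (X := X) (Y := Y) (A ∩ B) ω, D (A \ B) ω), D (B \ A) ω))
      (cutSide (A ∪ B)) :=
    (hA.trans (hsideMono Finset.subset_union_left)).prodMk
      (hDmono (Finset.sdiff_subset.trans Finset.subset_union_right))
  have hind : IndepFun (fun ω => (cutSide (A ∩ B) ω, D (A \ B) ω)) (D (B \ A))
      (m.prod (outputProduct m C)) := by
    have hdisj : Disjoint (relayNodes A) (relayNodes (B \ A)) :=
      (Finset.disjoint_map _).2 Finset.disjoint_sdiff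
    have hlast : Fin.last N ∉ relayNodes (B \ A) := by
      simp [relayNodes, Fin.castSucc_ne_last]
    have := indepFun_restrict_prod (C := C) hm hdisj
      (Finset.disjoint_insert_left.2 ⟨hlast, hdisj⟩)
    exact indepFun_of_determined this hA
  have hDB := hD (B \ A)
  have hDA := hD (A \ B)
  rw [klDiv_map_eq_of_determined _ _ (by fun_prop) (by fun_prop) (hside A B) hA,
    klDiv_map_eq_of_determined _ _ (by fun_prop) (by fun_prop) hBA hB,
    klDiv_map_eq_of_determined _ _ (by fun_prop) (by fun_prop) hU hU']
  exact klDiv_map_supermodular _ _ (measurable_cutSide _) hDA hDB hind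

end OneState

/-! ### Half-duplex relays: finiteness and submodularity -/

section OneState

variable {N : ℕ} {X Y : Fin (N + 1) → Type*}
  [∀ i, MeasurableSpace (X i)] [∀ i, MeasurableSpace (Y i)]
  {m : Measure (∀ i, X i)} [IsProbabilityMeasure m] {C : Kernel (∀ i, X i) (∀ i, Y i)}
  [IsMarkovKernel C]

/-- If the law of the output at node `i` does not depend on the input at node `i`, then this input
and this output are independent. -/
theorem map_input_output_eq (hm : m = Measure.pi fun i => m.map fun x => x i) (i : Fin (N + 1))
    (a : X i) (hhd : ∀ x, (C x).map (fun y => y i) = (C (Function.update x i a)).map fun y => y i) :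
    (m ⊗ₘ C).map (fun ω => (ω.1 i, ω.2 i))
      = (m.prod (outputProduct m C)).map fun ω => (ω.1 i, ω.2 i) := by
  have hi : Measurable fun x : (∀ i, X i) => x i := measurable_pi_apply i
  have hi' : Measurable fun y : (∀ i, Y i) => y i := measurable_pi_apply i
  have hupd : Measurable fun x : (∀ i, X i) => Function.update x i a := by fun_prop
  have hR := Measure.map_prod_map m (outputProduct m C) hi hi'
  rw [outputProduct_map_apply] at hR
  have hP : ∀ {f : X i × Y i → ℝ≥0∞}, Measurable f →
      ∫⁻ ω, f (ω.1 i, ω.2 i) ∂(m ⊗ₘ C) = ∫⁻ x, ∫⁻ y, f (x i, y) ∂((C.map fun y => y i) x) ∂m := by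
    intro f hf
    rw [Measure.lintegral_compProd (by fun_prop)]
    refine lintegral_congr fun x => ?_
    rw [Kernel.map_apply _ hi', lintegral_map (by fun_prop) hi']
  have hK : ∀ x, (C.map fun y => y i) x = (C.map fun y => y i) (Function.update x i a) := by
    intro x
    rw [Kernel.map_apply _ hi', Kernel.map_apply _ hi', hhd]
  -- Overwriting coordinate `i` by the constant `a` leaves a function of the other inputs, and the
  -- law of output `i` depends on the inputs only through it.
  have hind : IndepFun (fun x : (∀ i, X i) => x i) (fun x => Function.update x i a) m := by
    have h := indepFun_restrict_apply_of_eq_pi hm (S := {i}ᶜ) (i := i) (by simp)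
    refine (indepFun_of_determined h ?_).symm
    have : MeasurablyDetermined (fun x : (∀ i, X i) => Finset.univ.restrict (Function.update x i a))
        (({i}ᶜ : Finset (Fin (N + 1))).restrict : (∀ i, X i) → _) := by
      refine MeasurablyDetermined.restrict (f := fun x => Function.update x i a) fun j _ => ?_
      by_cases hj : j = i
      · subst hj
        exact ⟨fun _ => a, measurable_const, fun x => by simp⟩
      · exact ⟨fun v => v ⟨j, by simpa using hj⟩, measurable_pi_apply _, fun x => by simp [hj]⟩
    exact MeasurablyDetermined.trans
      ⟨fun v i => v ⟨i, Finset.mem_univ i⟩, by fun_prop, fun ω => rfl⟩ this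
  have hjoint := (indepFun_iff_map_prod_eq_prod_map_map hi.aemeasurable hupd.aemeasurable).1 hind
  have := Measure.isProbabilityMeasure_map (μ := m) hi.aemeasurable
  have := Measure.isProbabilityMeasure_map (μ := m) hupd.aemeasurable
  have := Kernel.IsMarkovKernel.map C hi'
  have hindep : ∀ {f : X i → (∀ i, X i) → ℝ≥0∞}, Measurable (Function.uncurry f) →
      ∫⁻ x, f (x i) (Function.update x i a) ∂m
        = ∫⁻ b, ∫⁻ x, f b (Function.update x i a) ∂m ∂(m.map fun x => x i) := by
    intro f hf
    have h1 := lintegral_map (μ := m) hf (hi.prodMk hupd)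
    rw [hjoint, lintegral_prod _ hf.aemeasurable] at h1
    refine h1.symm.trans (lintegral_congr fun b => ?_)
    rw [lintegral_map (by fun_prop) hupd]
    rfl
  refine Measure.ext_of_lintegral _ fun f hf => ?_
  have hR' : (m.prod (outputProduct m C)).map (fun ω => (ω.1 i, ω.2 i))
      = (m.map fun x => x i).prod ((m ⊗ₘ C).map fun ω => ω.2 i) := hR.symm
  rw [hR', lintegral_map hf (by fun_prop), hP hf, lintegral_prod _ hf.aemeasurable]
  have h2 := hindep (f := fun b x => ∫⁻ y, f (b, y) ∂((C.map fun y => y i) x)) (by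
    simp only [Function.uncurry_def]
    exact Measurable.lintegral_kernel_prod_right' (κ := (C.map fun y => y i).comap Prod.snd
      measurable_snd) (f := fun v : (X i × ∀ i, X i) × Y i => f (v.1.1, v.2)) (by fun_prop))
  simp only [← hK] at h2
  rw [h2]
  refine lintegral_congr fun b => ?_
  rw [lintegral_map (by fun_prop) (by fun_prop)]
  exact (hP (f := fun v => f (b, v.2)) (by fun_prop)).symm

variable [∀ i, StandardBorelSpace (X i)] [∀ i, Nonempty (X i)]

/-- At the destination, the divergence from independence is the information across the empty cut. -/
theorem klDiv_last_ne_top (hm : m = Measure.pi fun i => m.map fun x => x i)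
    (hC : ∀ x, C x = Measure.pi fun i => (C x).map fun y => y i)
    (hfin : stateCutInfo m C ∅ ≠ ⊤) :
    klDiv ((m ⊗ₘ C).map fun ω => (ω.1, ω.2 (Fin.last N)))
      ((m.prod (outputProduct m C)).map fun ω => (ω.1, ω.2 (Fin.last N))) ≠ ⊤ := by
  have h1 := klDiv_restrict_eq_sum m hC (insert (Fin.last N) (relayNodes ∅))
  rw [klDiv_cut_add_stateCutInfo hm] at h1
  -- For the empty cut the receiving side is just the destination output, whose law is the same
  -- under both measures.
  have h0 : (m ⊗ₘ C).map (cutSide ∅) = (m.prod (outputProduct m C)).map (cutSide ∅) := by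
    refine map_eq_of_determined (U := fun ω => ω.2 (Fin.last N)) (by fun_prop)
      (determined_cutSide_of_forall (by simp [relayNodes]) ?_) ?_
    · intro i hi
      obtain rfl : i = Fin.last N := by simpa [relayNodes] using hi
      exact MeasurablyDetermined.refl _
    · have : (fun ω : (∀ i, X i) × (∀ i, Y i) => ω.2 (Fin.last N))
          = (fun y => y (Fin.last N)) ∘ Prod.snd := rfl
      conv_rhs => rw [this, ← Measure.map_map (by fun_prop) measurable_snd, ← Measure.snd,
        Measure.snd_prod, outputProduct_map_apply]
  rw [h0, klDiv_self, zero_add] at h1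
  have h2 : insert (Fin.last N) (relayNodes (∅ : Finset (Fin N))) = {Fin.last N} := by
    simp [relayNodes]
  rw [h2, Finset.sum_singleton] at h1
  rwa [← h1]

/-- Split the chain rule at the pair of input and output of relay `k`. The divergence of this pair
vanishes by `map_input_output_eq`; the remaining term is at most the information across `{k}`, by
data processing. -/
theorem klDiv_relay_ne_top (hm : m = Measure.pi fun i => m.map fun x => x i)
    (k : Fin N) (a : X k.castSucc)
    (hhd : ∀ x, (C x).map (fun y => y k.castSucc)
      = (C (Function.update x k.castSucc a)).map fun y => y k.castSucc)
    (hfin : stateCutInfo m C {k} ≠ ⊤) :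
    klDiv ((m ⊗ₘ C).map fun ω => (ω.1, ω.2 k.castSucc))
      ((m.prod (outputProduct m C)).map fun ω => (ω.1, ω.2 k.castSucc)) ≠ ⊤ := by
  have hk : k.castSucc ∈ relayNodes {k} := by simp [relayNodes]
  let T : (∀ i, X i) × (∀ i, Y i) → X k.castSucc × Y k.castSucc := fun ω =>
    (ω.1 k.castSucc, ω.2 k.castSucc)
  have hT : Measurable T := by fun_prop
  have hTA : MeasurablyDetermined T (cutSide {k}) :=
    (input_determined_cutSide hk).prodMk (output_determined_cutSide (Finset.mem_insert_of_mem hk))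
  have := Measure.isProbabilityMeasure_map (μ := m)
    (Finset.measurable_restrict (X := X) (relayNodes {k})ᶜ).aemeasurable
  have hle := klDiv_map_prodMk_prod_le_of_determined (m ⊗ₘ C) (measurable_cutSide {k})
    (measurable_cutInput {k}) (m.map ((relayNodes {k})ᶜ).restrict) hTA
  have hne := ne_top_of_le_ne_top hfin hle
  have hind : IndepFun T (cutInput {k}) (m.prod (outputProduct m C)) := by
    have := indepFun_restrict_prod (C := C) hm (S := relayNodes {k}) (T := (relayNodes {k})ᶜ)
      (S' := insert (Fin.last N) (relayNodes {k})) (T' := ∅) disjoint_compl_right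
      (Finset.disjoint_empty_right _)
    exact indepFun_of_determined (this.comp measurable_id measurable_fst) hTA
  have hlaw : (m.prod (outputProduct m C)).map (cutInput {k})
      = m.map ((relayNodes {k})ᶜ).restrict := by
    have : cutInput (X := X) (Y := Y) {k} = ((relayNodes {k})ᶜ).restrict ∘ Prod.fst := rfl
    rw [this, ← Measure.map_map (Finset.measurable_restrict _) measurable_fst, ← Measure.fst,
      Measure.fst_prod]
  have h0 : (m ⊗ₘ C).map T = (m.prod (outputProduct m C)).map T :=
    map_input_output_eq hm k.castSucc a hhd
  have := Measure.isProbabilityMeasure_map (μ := m.prod (outputProduct m C)) hT.aemeasurable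
  have := Measure.isProbabilityMeasure_map (μ := m.prod (outputProduct m C))
    (measurable_cutInput {k}).aemeasurable
  rw [klDiv_map_eq_of_determined _ _ (T := fun ω => (ω.1, ω.2 k.castSucc))
      (U := fun ω => (T ω, cutInput {k} ω)) (by fun_prop) (by fun_prop),
    (indepFun_iff_map_prod_eq_prod_map_map (by fun_prop) (by fun_prop)).1 hind,
    klDiv_map_prodMk_prod _ hT (measurable_cutInput _), hlaw, h0, klDiv_self, zero_add, ← h0]
  · exact hne
  · have hTi : MeasurablyDetermined (fun ω => ω.1 k.castSucc) T :=
      ⟨Prod.fst, measurable_fst, fun _ => rfl⟩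
    refine MeasurablyDetermined.prodMk ?_
      (MeasurablyDetermined.prodMk_right_of_left ⟨Prod.snd, measurable_snd, fun _ => rfl⟩)
    have h : MeasurablyDetermined (fun ω => Finset.univ.restrict ω.1)
        (fun ω : (∀ i, X i) × (∀ i, Y i) => (T ω, cutInput {k} ω)) := by
      refine MeasurablyDetermined.restrict (f := Prod.fst) fun j _ => ?_
      by_cases hj : j ∈ relayNodes {k}
      · obtain rfl : j = k.castSucc := by simpa [relayNodes, eq_comm] using hj
        exact hTi.prodMk_right_of_left
      · exact (MeasurablyDetermined.apply_restrict (A := (relayNodes {k})ᶜ) Prod.fst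
          (by simpa using hj)).prodMk_right_of_right
    exact MeasurablyDetermined.trans
      ⟨fun v i => v ⟨i, Finset.mem_univ i⟩, by fun_prop, fun ω => rfl⟩ h
  · have hin : ∀ j, MeasurablyDetermined (fun ω => ω.1 j) (fun ω : (∀ i, X i) × (∀ i, Y i) =>
        (ω.1, ω.2 k.castSucc)) := fun j =>
      MeasurablyDetermined.prodMk_right_of_left ⟨fun x => x j, by fun_prop, fun _ => rfl⟩
    exact ((hin k.castSucc).prodMk (MeasurablyDetermined.refl _).prodMk_right_of_right).prodMk
      (MeasurablyDetermined.restrict fun j _ => hin j)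

variable [∀ i, StandardBorelSpace (Y i)] [∀ i, Nonempty (Y i)]

/-- With independent inputs, independent noises and half-duplex relays, the information across a cut
in a given state is submodular in the cut. -/
theorem stateCutInfo_submodular (hm : m = Measure.pi fun i => m.map fun x => x i)
    (hC : ∀ x, C x = Measure.pi fun i => (C x).map fun y => y i)
    (hhd : ∀ (k : Fin N) (a : X k.castSucc) x, (C x).map (fun y => y k.castSucc)
      = (C (Function.update x k.castSucc a)).map fun y => y k.castSucc)
    (hfin : ∀ A, stateCutInfo m C A ≠ ⊤) (A B : Finset (Fin N)) :
    stateCutInfo m C (A ∪ B) + stateCutInfo m C (A ∩ B)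
      ≤ stateCutInfo m C A + stateCutInfo m C B := by
  let I : Fin (N + 1) → ℝ≥0∞ := fun i => klDiv ((m ⊗ₘ C).map fun ω => (ω.1, ω.2 i))
    ((m.prod (outputProduct m C)).map fun ω => (ω.1, ω.2 i))
  let D : Finset (Fin N) → ℝ≥0∞ := fun A =>
    klDiv ((m ⊗ₘ C).map (cutSide A)) ((m.prod (outputProduct m C)).map (cutSide A))
  have hI : ∀ i, I i ≠ ⊤ := by
    intro i
    induction i using Fin.lastCases with
    | last => exact klDiv_last_ne_top hm hC (hfin ∅)
    | cast k => exact klDiv_relay_ne_top hm k (Classical.arbitrary _) (hhd k _) (hfin {k})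
  have hsum : ∀ A, ∑ i ∈ insert (Fin.last N) (relayNodes A), I i = D A + stateCutInfo m C A :=
    fun A => (klDiv_restrict_eq_sum m hC _).symm.trans (klDiv_cut_add_stateCutInfo hm A)
  have hDfin : ∀ A, D A ≠ ⊤ := by
    intro A
    have : D A + stateCutInfo m C A ≠ ⊤ := by
      rw [← hsum]
      exact ENNReal.sum_ne_top.2 fun i _ => hI i
    exact (ENNReal.add_ne_top.1 this).1
  have hmod := Finset.sum_union_inter (f := I)
    (s₁ := insert (Fin.last N) (relayNodes A)) (s₂ := insert (Fin.last N) (relayNodes B))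
  rw [← Finset.insert_union_distrib, ← Finset.insert_inter_distrib, relayNodes, relayNodes,
    ← Finset.map_union, ← Finset.map_inter] at hmod
  have hmod' : (D (A ∪ B) + stateCutInfo m C (A ∪ B)) + (D (A ∩ B) + stateCutInfo m C (A ∩ B))
      = (D A + stateCutInfo m C A) + (D B + stateCutInfo m C B) := by
    simp only [← hsum]
    exact hmod
  have hsup : D A + D B ≤ D (A ∪ B) + D (A ∩ B) := klDiv_cutSide_supermodular hm A B
  -- Finiteness lets the supermodular part be cancelled from the modular identity in `ℝ≥0∞`.
  have hne : D A + D B ≠ ⊤ := ENNReal.add_ne_top.2 ⟨hDfin A, hDfin B⟩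
  refine (ENNReal.add_le_add_iff_left hne).1 ?_
  calc D A + D B + (stateCutInfo m C (A ∪ B) + stateCutInfo m C (A ∩ B))
      ≤ D (A ∪ B) + D (A ∩ B) + (stateCutInfo m C (A ∪ B) + stateCutInfo m C (A ∩ B)) := by
        gcongr
    _ = D A + D B + (stateCutInfo m C A + stateCutInfo m C B) := by
        rw [add_add_add_comm, hmod', add_add_add_comm]

end OneState

/-! ### The cut information as a function of the schedule -/

section Schedule

variable {N : ℕ} {X Y : Fin (N + 1) → Type*}
  [∀ i, MeasurableSpace (X i)] [∀ i, MeasurableSpace (Y i)]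
  (W : Network N X Y) (Q : Kernel (State N) (∀ i, X i)) [IsMarkovKernel Q]

/-- The channel in the state `s`. -/
noncomputable def Network.stateChannel (s : State N) : Kernel (∀ i, X i) (∀ i, Y i) :=
  Kernel.sectR W.channel s

instance (s : State N) : IsMarkovKernel (W.stateChannel s) := by
  unfold Network.stateChannel
  infer_instance

theorem Network.stateChannel_apply (s : State N) (x : ∀ i, X i) :
    W.stateChannel s x = W.channel (s, x) := by
  simp [Network.stateChannel, Kernel.sectR_apply]

/-- The law of the output at a relay does not depend on the input at this relay. -/
theorem Network.stateChannel_map_update (s : State N) (k : Fin N) (a : X k.castSucc)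
    (x : ∀ i, X i) :
    (W.stateChannel s x).map (fun y => y k.castSucc)
      = (W.stateChannel s (Function.update x k.castSucc a)).map fun y => y k.castSucc := by
  simp only [W.stateChannel_apply]
  cases hs : s k with
  | false =>
    rw [W.listening k s x (Function.update x k.castSucc a) hs fun i hi => by simp [hi]]
  | true =>
    obtain ⟨ν, hν⟩ := W.transmitting k
    rw [(hν s x hs).1, (hν s _ hs).1]

theorem lintegral_jointLaw (p : PMF (State N)) {g : (State N × (∀ i, X i)) × (∀ i, Y i) → ℝ≥0∞}
    (hg : Measurable g) :
    ∫⁻ ω, g ω ∂(jointLaw W Q p)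
      = ∫⁻ s, ∫⁻ v, g ((s, v.1), v.2) ∂(Q s ⊗ₘ W.stateChannel s) ∂p.toMeasure := by
  rw [jointLaw, Measure.lintegral_compProd hg, Measure.lintegral_compProd (by fun_prop)]
  refine lintegral_congr fun s => ?_
  rw [Measure.lintegral_compProd (by fun_prop)]
  refine lintegral_congr fun x => ?_
  rw [W.stateChannel_apply]

theorem lintegral_compProd_fst {α β : Type*} [MeasurableSpace α] [MeasurableSpace β]
    (m : Measure α) [SFinite m] (C : Kernel α β) [IsMarkovKernel C] {g : α → ℝ≥0∞}
    (hg : Measurable g) : ∫⁻ v, g v.1 ∂(m ⊗ₘ C) = ∫⁻ x, g x ∂m := by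
  rw [Measure.lintegral_compProd (by fun_prop)]
  simp

variable [∀ i, StandardBorelSpace (X i)] [∀ i, Nonempty (X i)]

/-- Given the state, the inputs outside `A` do not depend on the inputs in `A`. -/
theorem condDistrib_cutInput (hQ : IndependentInputs Q) (p : PMF (State N)) (A : Finset (Fin N)) :
    condDistrib (fun ω : (State N × (∀ i, X i)) × (∀ i, Y i) => ((relayNodes A)ᶜ).restrict ω.1.2)
        (fun ω => ((relayNodes A).restrict ω.1.2, ω.1.1)) (jointLaw W Q p)
      =ᵐ[(jointLaw W Q p).map fun ω => ((relayNodes A).restrict ω.1.2, ω.1.1)]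
        ((Q.map ((relayNodes A)ᶜ).restrict).comap Prod.snd measurable_snd :
          Kernel ((∀ i : relayNodes A, X i) × State N) (∀ i : ↥(relayNodes A)ᶜ, X i)) := by
  have hr : ∀ T : Finset (Fin (N + 1)), Measurable (T.restrict : (∀ i, X i) → _) :=
    fun T => Finset.measurable_restrict T
  have := Kernel.IsMarkovKernel.map Q (hr (relayNodes A)ᶜ)
  refine condDistrib_ae_eq_of_measure_eq_compProd_of_measurable (by fun_prop) (by fun_prop) ?_
  refine Measure.ext_of_lintegral _ fun f hf => ?_
  have hmeas := Measurable.lintegral_kernel_prod_right'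
    (κ := (Q.map ((relayNodes A)ᶜ).restrict).comap
      (Prod.snd : (∀ i : relayNodes A, X i) × State N → State N) measurable_snd) hf
  rw [lintegral_map hf (by fun_prop), lintegral_jointLaw W Q p (by fun_prop),
    Measure.lintegral_compProd hf, lintegral_map hmeas (by fun_prop),
    lintegral_jointLaw W Q p (g := fun ω => ∫⁻ u, f (((relayNodes A).restrict ω.1.2, ω.1.1), u)
      ∂((Q.map ((relayNodes A)ᶜ).restrict).comap
        (Prod.snd : (∀ i : relayNodes A, X i) × State N → State N) measurable_snd)
        ((relayNodes A).restrict ω.1.2, ω.1.1)) (hmeas.comp (by fun_prop))]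
  refine lintegral_congr fun s => ?_
  have hind := (indepFun_iff_map_prod_eq_prod_map_map (hr (relayNodes A)).aemeasurable
    (hr (relayNodes A)ᶜ).aemeasurable).1
      (indepFun_restrict_of_eq_pi (hQ s) (disjoint_compl_right (a := relayNodes A)))
  have := Measure.isProbabilityMeasure_map (μ := Q s) (hr (relayNodes A)ᶜ).aemeasurable
  simp only [Kernel.comap_apply]
  rw [lintegral_compProd_fst (Q s) (W.stateChannel s)
      (g := fun x => f (((relayNodes A).restrict x, s), ((relayNodes A)ᶜ).restrict x))
      (by fun_prop),
    lintegral_compProd_fst (Q s) (W.stateChannel s)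
      (g := fun x => ∫⁻ u, f (((relayNodes A).restrict x, s), u)
        ∂((Q.map ((relayNodes A)ᶜ).restrict) s)) (by fun_prop),
    Kernel.map_apply _ (hr _),
    ← lintegral_map (μ := Q s) (g := fun x => ((relayNodes A).restrict x,
        ((relayNodes A)ᶜ).restrict x)) (f := fun v => f ((v.1, s), v.2)) (by fun_prop)
      (by fun_prop), hind, lintegral_prod _ (by fun_prop),
    lintegral_map (by fun_prop) (hr _)]

variable [∀ i, StandardBorelSpace (Y i)] [∀ i, Nonempty (Y i)]

/-- The cut information is linear in the schedule. -/
theorem cutInfo_eq_sum (hQ : IndependentInputs Q) (p : PMF (State N)) (A : Finset (Fin N)) :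
    cutInfo W Q p A = ∑ s, p s * stateCutInfo (Q s) (W.stateChannel s) A := by
  have hr : ∀ T : Finset (Fin (N + 1)), Measurable (T.restrict : (∀ i, X i) → _) :=
    fun T => Finset.measurable_restrict T
  have := Kernel.IsMarkovKernel.map Q (hr (relayNodes A)ᶜ)
  set U := fun ω : (State N × (∀ i, X i)) × (∀ i, Y i) => ((relayNodes A)ᶜ).restrict ω.1.2
  set V := fun ω : (State N × (∀ i, X i)) × (∀ i, Y i) =>
    (insert (Fin.last N) (relayNodes A)).restrict ω.2
  set Z := fun ω : (State N × (∀ i, X i)) × (∀ i, Y i) =>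
    ((relayNodes A).restrict ω.1.2, ω.1.1)
  have hUm : Measurable U := by fun_prop
  have hVm : Measurable V := by fun_prop
  have hZm : Measurable Z := by fun_prop
  let κ : Kernel (State N) ((∀ i, X i) × (∀ i, Y i)) := Q ⊗ₖ W.channel
  have hκ : ∀ s, κ s = Q s ⊗ₘ W.stateChannel s :=
    fun s => Kernel.compProd_apply_eq_compProd_sectR Q W.channel s
  have := Kernel.IsMarkovKernel.map κ (measurable_cutSide A)
  have hpair : Measurable fun ω : (∀ i, X i) × (∀ i, Y i) => (cutSide A ω, cutInput A ω) := by
    fun_prop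
  have := Kernel.IsMarkovKernel.map κ hpair
  have := Measure.isProbabilityMeasure_map (μ := jointLaw W Q p) hZm.aemeasurable
  -- `Φ` reorders coordinates so that the state comes first. Both laws then become compositions over
  -- the schedule, and the divergence splits into a sum over states.
  let Φ : ((∀ i : relayNodes A, X i) × State N) × ((∀ i : ↥(relayNodes A)ᶜ, X i) ×
      (∀ i : ↥(insert (Fin.last N) (relayNodes A)), Y i)) →
      State N × (((∀ i : relayNodes A, X i) ×
        (∀ i : ↥(insert (Fin.last N) (relayNodes A)), Y i)) × (∀ i : ↥(relayNodes A)ᶜ, X i)) :=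
    fun v => (v.1.2, ((v.1.1, v.2.2), v.2.1))
  have hΦ : Measurable Φ := by fun_prop
  have hleft : ((jointLaw W Q p).map fun ω => (Z ω, (U ω, V ω))).map Φ
      = p.toMeasure ⊗ₘ κ.map fun ω => (cutSide A ω, cutInput A ω) := by
    refine Measure.ext_of_lintegral _ fun f hf => ?_
    rw [lintegral_map hf hΦ, lintegral_map (by fun_prop) (by fun_prop),
      lintegral_jointLaw W Q p (by fun_prop), Measure.lintegral_compProd hf]
    refine lintegral_congr fun s => ?_
    rw [Kernel.map_apply _ hpair, lintegral_map (by fun_prop) hpair, hκ]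
    rfl
  have hright : ((jointLaw W Q p).map Z ⊗ₘ
      (condDistrib U Z (jointLaw W Q p) ×ₖ condDistrib V Z (jointLaw W Q p))).map Φ
      = p.toMeasure ⊗ₘ (κ.map (cutSide A) ×ₖ Q.map ((relayNodes A)ᶜ).restrict) := by
    have hcongr : (condDistrib U Z (jointLaw W Q p) ×ₖ condDistrib V Z (jointLaw W Q p))
        =ᵐ[(jointLaw W Q p).map Z]
        ((Q.map ((relayNodes A)ᶜ).restrict).comap Prod.snd measurable_snd
          ×ₖ condDistrib V Z (jointLaw W Q p)) := by
      filter_upwards [condDistrib_cutInput W Q hQ p A] with z hz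
      rw [Kernel.prod_apply, Kernel.prod_apply, hz]
    rw [Measure.compProd_congr hcongr]
    refine Measure.ext_of_lintegral _ fun f hf => ?_
    rw [lintegral_map hf hΦ, Measure.lintegral_compProd (by fun_prop)]
    have hswap : ∀ z, ∫⁻ b, f (Φ (z, b)) ∂(((Q.map ((relayNodes A)ᶜ).restrict).comap Prod.snd
          measurable_snd ×ₖ condDistrib V Z (jointLaw W Q p)) z)
        = ∫⁻ v, ∫⁻ u, f (z.2, ((z.1, v), u)) ∂((Q.map ((relayNodes A)ᶜ).restrict) z.2)
          ∂(condDistrib V Z (jointLaw W Q p) z) := by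
      intro z
      rw [Kernel.prod_apply, lintegral_prod_symm _ (by fun_prop)]
      rfl
    let g : ((∀ i : relayNodes A, X i) × State N) ×
        (∀ i : ↥(insert (Fin.last N) (relayNodes A)), Y i) → ℝ≥0∞ := fun v =>
        ∫⁻ u, f (v.1.2, ((v.1.1, v.2), u)) ∂((Q.map ((relayNodes A)ᶜ).restrict) v.1.2)
    have hmeas : Measurable g :=
      Measurable.lintegral_kernel_prod_right'
        (κ := (Q.map ((relayNodes A)ᶜ).restrict).comap
          (fun v : ((∀ i : relayNodes A, X i) × State N) ×
            (∀ i : ↥(insert (Fin.last N) (relayNodes A)), Y i) => v.1.2) (by fun_prop))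
        (f := fun w => f (w.1.1.2, ((w.1.1.1, w.1.2), w.2))) (by fun_prop)
    -- The conditional law of `V` need not be computed: composed with the law of `Z` it gives back
    -- the joint law of `(Z, V)`.
    rw [lintegral_congr hswap, ← Measure.lintegral_compProd (f := g) hmeas,
      compProd_map_condDistrib hVm.aemeasurable, lintegral_map hmeas (hZm.prodMk hVm),
      lintegral_jointLaw W Q p (g := fun ω => g (Z ω, V ω)) (hmeas.comp (hZm.prodMk hVm)),
      Measure.lintegral_compProd hf]
    refine lintegral_congr fun s => ?_
    rw [Kernel.prod_apply, lintegral_prod _ (by fun_prop),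
      Kernel.map_apply _ (measurable_cutSide A),
      lintegral_map (by fun_prop) (measurable_cutSide A), hκ]
    rfl
  rw [cutInfo, condMutualInfo, ← klDiv_map_of_leftInverse _ _ (g := Φ)
    (h := fun w => ((w.2.1.1, w.1), (w.2.2, w.2.1.2))) hΦ (by fun_prop) (fun _ => rfl), hleft,
    hright, klDiv_compProd_right_eq_sum]
  refine Finset.sum_congr rfl fun s _ => ?_
  rw [PMF.toMeasure_apply_singleton _ _ (measurableSet_singleton s), stateCutInfo,
    Kernel.map_apply _ hpair, Kernel.prod_apply, Kernel.map_apply _ (measurable_cutSide A),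
    Kernel.map_apply _ (hr _), hκ]

end Schedule

/-! ### Sparse optimal schedules -/

/-- Some optimal schedule has at most `N + 1` active states. -/
theorem exists_sparse_optimal_schedule {N : ℕ} {X Y : Fin (N + 1) → Type*}
    [∀ i, MeasurableSpace (X i)] [∀ i, StandardBorelSpace (X i)] [∀ i, Nonempty (X i)]
    [∀ i, MeasurableSpace (Y i)] [∀ i, StandardBorelSpace (Y i)] [∀ i, Nonempty (Y i)]
    (W : Network N X Y) (hW : W.IndependentNoises)
    (Q : Kernel (State N) (∀ i, X i))
    [IsMarkovKernel Q] (hQ : IndependentInputs Q)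
    (hfin : ∀ (p : PMF (State N)) (A : Finset (Fin N)), cutInfo W Q p A ≠ ⊤) :
    ∃ p : PMF (State N), p.support.ncard ≤ N + 1 ∧
      ∀ q : PMF (State N), minCutInfo W Q q ≤ minCutInfo W Q p := by
  classical
  let F : State N → Finset (Fin N) → ENNReal := fun s A => stateCutInfo (Q s) (W.stateChannel s) A
  have hF : ∀ s A, F s A ≠ ⊤ := by
    intro s A
    -- The deterministic schedule at `s` turns finiteness of the cut information into finiteness in
    -- each state.
    have h := hfin (PMF.pure s) A
    rw [cutInfo_eq_sum W Q hQ] at h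
    have h' := ENNReal.sum_ne_top.1 h s (Finset.mem_univ s)
    simpa using h'
  have hsub : ∀ s A B, (F s (A ∪ B)).toReal + (F s (A ∩ B)).toReal
      ≤ (F s A).toReal + (F s B).toReal := by
    intro s A B
    rw [← ENNReal.toReal_add (hF _ _) (hF _ _), ← ENNReal.toReal_add (hF _ _) (hF _ _)]
    refine ENNReal.toReal_mono (ENNReal.add_ne_top.2 ⟨hF _ _, hF _ _⟩) ?_
    refine stateCutInfo_submodular (hQ s) (fun x => ?_)
      (fun k a x => W.stateChannel_map_update s k a x) (hF s) A B
    rw [W.stateChannel_apply]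
    exact hW s x
  have hcut : ∀ (q : PMF (State N)) A, cutInfo W Q q A
      = ENNReal.ofReal (∑ s, (q s).toReal * (F s A).toReal) := by
    intro q A
    rw [cutInfo_eq_sum W Q hQ, ENNReal.ofReal_sum_of_nonneg fun s _ => by positivity]
    refine Finset.sum_congr rfl fun s _ => ?_
    rw [ENNReal.ofReal_mul ENNReal.toReal_nonneg, ENNReal.ofReal_toReal (q.apply_ne_top s),
      ENNReal.ofReal_toReal (hF s A)]
  obtain ⟨r, hr, hcard, hopt⟩ := exists_sparse_optimal (f := fun s A => (F s A).toReal) hsub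
  let p : PMF (State N) := PMF.ofFintype (fun s => ENNReal.ofReal (r s)) (by
    rw [← ENNReal.ofReal_sum_of_nonneg fun s _ => hr.1 s, hr.2, ENNReal.ofReal_one])
  have hp : ∀ s, (p s).toReal = r s := fun s => by
    simp [p, ENNReal.toReal_ofReal (hr.1 s)]
  refine ⟨p, ?_, fun q => le_iInf fun B => ?_⟩
  · have : p.support = ↑(Finset.univ.filter fun s => r s ≠ 0) := by
      ext s
      simp [p, (hr.1 s).lt_iff_ne']
    rw [this, Set.ncard_coe_finset]
    exact hcard
  · obtain ⟨A, -, hA⟩ := Finset.exists_mem_eq_inf' (s := (Finset.univ : Finset (Finset (Fin N))))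
      Finset.univ_nonempty fun A => ∑ s, (q s).toReal * (F s A).toReal
    have hq : (fun s => (q s).toReal) ∈ stdSimplex ℝ (State N) := by
      refine ⟨fun s => ENNReal.toReal_nonneg, ?_⟩
      have hsum := q.tsum_coe
      rw [tsum_fintype] at hsum
      rw [← ENNReal.toReal_sum fun s _ => q.apply_ne_top s, hsum, ENNReal.toReal_one]
    refine (iInf_le _ A).trans ?_
    rw [hcut, hcut]
    refine ENNReal.ofReal_le_ofReal ?_
    simp only [hp]
    exact hA.symm.le.trans ((hopt _ hq).trans (worstPayoff_le _ r B))

end HalfDuplex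

theorem theorem1 {N : ℕ} {X Y : Fin (N + 1) → Type*}
    [∀ i, MeasurableSpace (X i)] [∀ i, StandardBorelSpace (X i)] [∀ i, Nonempty (X i)]
    [∀ i, MeasurableSpace (Y i)] [∀ i, StandardBorelSpace (Y i)] [∀ i, Nonempty (Y i)]
    (W : HalfDuplex.Network N X Y) (hW : W.IndependentNoises)
    (Q : ProbabilityTheory.Kernel (HalfDuplex.State N) (∀ i, X i))
    [ProbabilityTheory.IsMarkovKernel Q] (hQ : HalfDuplex.IndependentInputs Q)
    (hfin : ∀ (p : PMF (HalfDuplex.State N)) (A : Finset (Fin N)),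
      HalfDuplex.cutInfo W Q p A ≠ ⊤) :
    ∃ p : PMF (HalfDuplex.State N),
      p.support.ncard ≤ N + 1 ∧
      HalfDuplex.minCutInfo W Q p = HalfDuplex.fixedScheduleRate W Q ∧
      ∀ (B : HalfDuplex.InputConstraint X) (G₁ G₂ : NNReal),
        HalfDuplex.fixedScheduleRate W Q ≤ HalfDuplex.capacity W B + G₁ →
        HalfDuplex.capacity W B ≤ HalfDuplex.fixedScheduleRate W Q + G₂ →
        HalfDuplex.minCutInfo W Q p ≤ HalfDuplex.capacity W B + G₁ ∧
        HalfDuplex.capacity W B ≤ HalfDuplex.minCutInfo W Q p + G₂ := by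
  obtain ⟨p, hcard, hopt⟩ := HalfDuplex.exists_sparse_optimal_schedule W hW Q hQ hfin
  have heq : HalfDuplex.minCutInfo W Q p = HalfDuplex.fixedScheduleRate W Q :=
    le_antisymm (le_iSup (HalfDuplex.minCutInfo W Q) p) (iSup_le hopt)
  exact ⟨p, hcard, heq, fun B G₁ G₂ h₁ h₂ => by rw [heq]; exact ⟨h₁, h₂⟩⟩
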